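/- Let $E/\mathbb{Q}$ be an elliptic curve of conductor $N$. There is an open neighbourhood $U$ of $1$ in $G_{\mathbb{Q}}=\mathrm{Gal}(\overline{\mathbb{Q}}/\mathbb{Q})$, depending only on $E$, with the following property. Let $k$ be a finite field of characteristic $2$ and put $V=E[2]\otimes_{\mathbb{F}_2}k$. Let $w\nmid 2N$ be a prime such that $\mathrm{Frob}_w^2\in U$ for some Frobenius element $\mathrm{Frob}_w\in G_{\mathbb{Q}}$ at $w$, and such that $\dim_k H^1(\mathbb{Q}_w,V)=2$. The degree two map $E\to\mathbb{P}^1$ given by the linear system $|2\infty|$ turns translation by $2$-torsion points into a homomorphism $E[2]\to\mathrm{PGL}_2$. Let $$Q_w: H^1(\mathbb{Q}_w,E[2])\to H^1(\mathbb{Q}_w,\mathrm{PGL}_2)\to H^2(\mathbb{Q}_w,\mathbb{G}_m)[2]\cong\mathbb{Z}/2\mathbb{Z}$$ be the composite of the induced map with the connecting map of $1\to\mathbb{G}_m\to\mathrm{GL}_2\to\mathrm{PGL}_2\to1$. Then: 1. $V$ has a unique $G_{\mathbb{Q}_w}$-stable $k$-line $W$; 2. $Q_w$ extends uniquely to a $k$-valued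 quadratic form, again denoted $Q_w$, on the $k$-vector space $H^1(\mathbb{Q}_w,V)=H^1(\mathbb{Q}_w,E[2])\otimes k$; 3. $\mathcal{L}_w'=\mathrm{im}\big(H^1(\mathbb{Q}_w,W)\to H^1(\mathbb{Q}_w,V)\big)$ is a $k$-line, and $Q_w|_{\mathcal{L}_w'}=0$, i.e. $\mathcal{L}_w'$ is an isotropic line for $Q_w$. -/

import Mathlib

open scoped Classical TensorProduct MatrixGroups LinearAlgebra.Projectivization Topology

noncomputable section

namespace GalCoh

/-! ### First cohomology of a topological group with coefficients in a discrete linear representation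

The coefficient module carries the discrete topology, so a cochain is continuous iff it is
locally constant. -/

section AbelianH1

variable {k k' G M N : Type*} [CommRing k] [CommRing k'] [Group G] [TopologicalSpace G]
  [AddCommGroup M] [Module k M] [AddCommGroup N] [Module k' N]

/-- Continuous crossed homomorphisms `c : G → M`, i.e. `c (g h) = c g + g • c h`. -/
def Z1 (ρ : Representation k G M) : Submodule k (G → M) where
  carrier := {c | IsLocallyConstant c ∧ ∀ g h, c (g * h) = c g + ρ g (c h)}
  zero_mem' := ⟨IsLocallyConstant.const 0, fun g h => by simp⟩
  add_mem' := by
    rintro a b ⟨ha, ha'⟩ ⟨hb, hb'⟩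
    exact ⟨ha.add hb, fun g h => by simp only [Pi.add_apply, ha', hb', map_add]; abel⟩
  smul_mem' := by
    rintro r a ⟨ha, ha'⟩
    exact ⟨ha.comp (fun m => r • m), fun g h => by simp [ha', smul_add]⟩

/-- Principal crossed homomorphisms `g ↦ g • m - m`. -/
def B1 (ρ : Representation k G M) : Submodule k (G → M) :=
  LinearMap.range (LinearMap.pi fun g => ρ g - LinearMap.id)

/-- `H¹(G, M)`: continuous crossed homomorphisms modulo principal ones. -/
abbrev H1 (ρ : Representation k G M) : Type _ := Z1 ρ ⧸ (B1 ρ).comap (Z1 ρ).subtype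

/-- Postcomposition of a crossed homomorphism with an equivariant (semilinear) map. -/
def Z1.map {σ : k →+* k'} (ρ : Representation k G M) (ρ' : Representation k' G N)
    (f : M →ₛₗ[σ] N) (hf : ∀ g m, f (ρ g m) = ρ' g (f m)) : Z1 ρ →ₛₗ[σ] Z1 ρ' where
  toFun c := ⟨fun g => f (c.1 g), c.2.1.comp f, fun g h => by
    change f (c.1 (g * h)) = f (c.1 g) + ρ' g (f (c.1 h))
    rw [c.2.2, map_add, hf]⟩
  map_add' a b := by ext g; simp
  map_smul' r a := by ext g; simp

/-- The map `H¹(G, M) → H¹(G, N)` induced by an equivariant (semilinear) map `M → N`. -/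
def H1.map {σ : k →+* k'} (ρ : Representation k G M) (ρ' : Representation k' G N)
    (f : M →ₛₗ[σ] N) (hf : ∀ g m, f (ρ g m) = ρ' g (f m)) : H1 ρ →ₛₗ[σ] H1 ρ' :=
  Submodule.mapQ _ _ (Z1.map ρ ρ' f hf) (by
    rintro c ⟨m, hm⟩
    refine ⟨f m, ?_⟩
    funext g
    have := congrFun hm g
    simp only [LinearMap.pi_apply, LinearMap.sub_apply, LinearMap.id_apply] at this ⊢
    rw [← hf, ← map_sub, this]
    rfl)

/-- The image of `H¹(G, W) → H¹(G, M)` for a subrepresentation `W` of `M`. -/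
def imageOfSub (ρ : Representation k G M) (W : Subrepresentation ρ) : Submodule k (H1 ρ) :=
  LinearMap.range (H1.map W.toRepresentation ρ W.toSubmodule.subtype fun _ _ => rfl)

end AbelianH1

/-! ### Second cohomology with coefficients in a commutative group, written multiplicatively -/

section H2

variable (G A : Type*) [Group G] [TopologicalSpace G] [CommGroup A] [MulDistribMulAction G A]

/-- Continuous 2-cocycles (`A` discrete). -/
def Z2 : Subgroup (G × G → A) where
  carrier := {f | IsLocallyConstant f ∧ groupCohomology.IsMulCocycle₂ f}
  one_mem' := ⟨IsLocallyConstant.const 1, fun g h j => by simp⟩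
  mul_mem' := by
    rintro a b ⟨ha, ha'⟩ ⟨hb, hb'⟩
    refine ⟨ha.mul hb, fun g h j => ?_⟩
    simp only [Pi.mul_apply, smul_mul']
    rw [mul_mul_mul_comm, ha', hb', mul_mul_mul_comm]
  inv_mem' := by
    rintro a ⟨ha, ha'⟩
    refine ⟨ha.inv, fun g h j => ?_⟩
    simp only [Pi.inv_apply, smul_inv', ← mul_inv]
    rw [ha']

/-- Coboundaries of continuous 1-cochains: `f (g, h) = g • x h / x (g h) * x g`. -/
def B2 : Subgroup (G × G → A) where
  carrier := {f | ∃ x : G → A, IsLocallyConstant x ∧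
    ∀ g h, g • x h / x (g * h) * x g = f (g, h)}
  one_mem' := ⟨1, IsLocallyConstant.const 1, fun g h => by simp⟩
  mul_mem' := by
    rintro a b ⟨x, hx, hx'⟩ ⟨y, hy, hy'⟩
    refine ⟨x * y, hx.mul hy, fun g h => ?_⟩
    simp only [Pi.mul_apply, smul_mul', ← hx', ← hy', div_eq_mul_inv, mul_inv]
    simp only [mul_assoc, mul_left_comm, mul_comm]
  inv_mem' := by
    rintro a ⟨x, hx, hx'⟩
    refine ⟨x⁻¹, hx.inv, fun g h => ?_⟩
    simp only [Pi.inv_apply, smul_inv', ← hx', div_eq_mul_inv, mul_inv]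

/-- `H²(G, A)`, with group law written multiplicatively. -/
abbrev H2 : Type _ := Z2 G A ⧸ (B2 G A).subgroupOf (Z2 G A)

end H2

/-! ### Nonabelian first cohomology and the connecting map of a central extension -/

section Nonabelian

variable (G C : Type*) [Group G] [TopologicalSpace G] [Group C] [MulDistribMulAction G C]

/-- Continuous 1-cocycles with values in a possibly nonabelian discrete group. -/
abbrev NZ1 : Type _ := {a : G → C // IsLocallyConstant a ∧ ∀ g h, a (g * h) = a g * g • a h}

/-- Two cocycles are cohomologous if `a' g = c⁻¹ * a g * g • c` for some `c`. -/
instance NZ1.setoid : Setoid (NZ1 G C) where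
  r a a' := ∃ c : C, ∀ g, a'.1 g = c⁻¹ * a.1 g * g • c
  iseqv :=
    { refl := fun a => ⟨1, fun g => by simp⟩
      symm := by
        rintro a b ⟨c, hc⟩
        exact ⟨c⁻¹, fun g => by rw [hc]; simp [smul_inv', mul_assoc]⟩
      trans := by
        rintro a b d ⟨x, hx⟩ ⟨y, hy⟩
        exact ⟨x * y, fun g => by rw [hy, hx]; simp [smul_mul', mul_assoc]⟩ }

/-- The pointed set `H¹(G, C)`. -/
def NH1 : Type _ := Quotient (NZ1.setoid G C)

end Nonabelian

section Connecting

variable {G A B C : Type*} [Group G] [TopologicalSpace G]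
  [CommGroup A] [Group B] [Group C]
  [MulDistribMulAction G A] [MulDistribMulAction G B] [MulDistribMulAction G C]

/-- A central extension `1 → A → B → C → 1` of discrete groups with continuous action of `G`. -/
structure CentralExt (G A B C : Type*) [Group G] [TopologicalSpace G]
    [CommGroup A] [Group B] [Group C]
    [MulDistribMulAction G A] [MulDistribMulAction G B] [MulDistribMulAction G C] where
  i : A →* B
  p : B →* C
  i_smul : ∀ (g : G) a, i (g • a) = g • i a
  p_smul : ∀ (g : G) b, p (g • b) = g • p b
  inj : Function.Injective i
  surj : Function.Surjective p
  exact : ∀ b, p b = 1 ↔ ∃ a, i a = b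
  central : ∀ a b, i a * b = b * i a
  smooth : ∀ b : B, IsLocallyConstant fun g : G => g • b

namespace CentralExt

variable (X : CentralExt G A B C)

/-- A continuous lift to `B` of a continuous cochain with values in `C`. -/
def lift (a : G → C) (g : G) : B := Function.surjInv X.surj (a g)

lemma p_lift (a : G → C) (g : G) : X.p (X.lift a g) = a g := Function.surjInv_eq X.surj (a g)

lemma lift_lc {a : G → C} (ha : IsLocallyConstant a) : IsLocallyConstant (X.lift a) :=
  ha.comp (Function.surjInv X.surj)

lemma smul_lc (X : CentralExt G A B C) {T : Type*} [TopologicalSpace T] {u : T → G} (hu : Continuous u) {b : T → B}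
    (hb : IsLocallyConstant b) : IsLocallyConstant fun t => u t • b t := by
  rw [IsLocallyConstant.iff_eventually_eq]
  intro t
  filter_upwards [hb.eventually_eq t,
    hu.continuousAt.eventually ((X.smooth (b t)).eventually_eq (u t))] with s h1 h2
  rw [h1, h2]

lemma of_i_lc {T : Type*} [TopologicalSpace T] {f : T → A}
    (h : IsLocallyConstant fun t => X.i (f t)) : IsLocallyConstant f := by
  rw [IsLocallyConstant.iff_eventually_eq] at h ⊢
  intro t
  filter_upwards [h t] with s hs using X.inj hs

lemma mem_ker (a : NZ1 G C) (g h : G) :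
    ∃ x, X.i x = X.lift a.1 g * g • X.lift a.1 h * (X.lift a.1 (g * h))⁻¹ := by
  rw [← X.exact]
  simp [X.p_smul, p_lift, a.2.2]

/-- The 2-cochain `(g, h) ↦ b g * g • b h * (b (g h))⁻¹` where `b` is a lift of the cocycle. -/
def delta (a : NZ1 G C) (x : G × G) : A := (X.mem_ker a x.1 x.2).choose

lemma i_delta (a : NZ1 G C) (g h : G) :
    X.i (X.delta a (g, h)) * X.lift a.1 (g * h) = X.lift a.1 g * g • X.lift a.1 h := by
  rw [delta, (X.mem_ker a g h).choose_spec, inv_mul_cancel_right]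

variable [IsTopologicalGroup G]

lemma delta_mem (a : NZ1 G C) : X.delta a ∈ Z2 G A := by
  have hl := X.lift_lc a.2.1
  constructor
  · apply X.of_i_lc
    have : (fun t => X.i (X.delta a t)) =
        fun t : G × G => X.lift a.1 t.1 * t.1 • X.lift a.1 t.2 * (X.lift a.1 (t.1 * t.2))⁻¹ := by
      funext t
      rw [eq_mul_inv_iff_mul_eq, i_delta]
    rw [this]
    exact ((hl.comp_continuous continuous_fst).mul
      (X.smul_lc continuous_fst (hl.comp_continuous continuous_snd))).mul
      (hl.comp_continuous continuous_mul).inv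
  · intro g h j
    apply X.inj
    apply mul_right_cancel (b := X.lift a.1 (g * h * j))
    have h1 := X.i_delta a (g * h) j
    have h2 := X.i_delta a g h
    have h3 := X.i_delta a g (h * j)
    have h4 := congrArg (g • ·) (X.i_delta a h j)
    simp only [smul_mul', ← mul_smul] at h4
    rw [← mul_assoc] at h3
    have c : g • X.i (X.delta a (h, j)) * X.lift a.1 g =
        X.lift a.1 g * g • X.i (X.delta a (h, j)) := by
      rw [← X.i_smul, X.central]
    rw [map_mul, map_mul, X.i_smul]
    calc _ = X.i (X.delta a (g, h)) * (X.i (X.delta a (g * h, j)) * X.lift a.1 (g * h * j)) := by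
          rw [X.central (X.delta a (g * h, j)) (X.i (X.delta a (g, h))), mul_assoc]
      _ = X.lift a.1 g * (g • X.lift a.1 h * (g * h) • X.lift a.1 j) := by
          rw [h1, ← mul_assoc, h2, mul_assoc]
      _ = g • X.i (X.delta a (h, j)) * (X.lift a.1 g * g • X.lift a.1 (h * j)) := by
          rw [← h4, ← mul_assoc, ← c, mul_assoc]
      _ = _ := by rw [← h3]; simp only [mul_assoc]

/-- The connecting map on cocycles. -/
def deltaZ (a : NZ1 G C) : H2 G A := QuotientGroup.mk ⟨X.delta a, X.delta_mem a⟩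

lemma deltaZ_eq {a a' : NZ1 G C} (h : ∃ c : C, ∀ g, a'.1 g = c⁻¹ * a.1 g * g • c) :
    X.deltaZ a = X.deltaZ a' := by
  obtain ⟨c, hc⟩ := h
  obtain ⟨β, rfl⟩ := X.surj c
  have key : ∀ g, ∃ x, X.i x = X.lift a'.1 g * (β⁻¹ * X.lift a.1 g * g • β)⁻¹ := by
    intro g
    rw [← X.exact]
    simp [X.p_smul, p_lift, hc]
  choose u hu using key
  have hu' : ∀ g, X.lift a'.1 g = X.i (u g) * (β⁻¹ * X.lift a.1 g * g • β) := fun g => by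
    rw [hu, inv_mul_cancel_right]
  have hulc : IsLocallyConstant u := by
    apply X.of_i_lc
    simp only [hu]
    exact (X.lift_lc a'.2.1).mul
      (((IsLocallyConstant.const β⁻¹).mul (X.lift_lc a.2.1)).mul (X.smooth β)).inv
  refine QuotientGroup.eq.2 ⟨u, hulc, fun g h => ?_⟩
  have e : X.delta a' (g, h) * u (g * h) = X.delta a (g, h) * (u g * g • u h) := by
    apply X.inj
    apply mul_right_cancel (b := β⁻¹ * X.lift a.1 (g * h) * (g * h) • β)
    have h1 := X.i_delta a' g h
    rw [hu' g, hu' h, hu' (g * h)] at h1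
    rw [map_mul, mul_assoc, h1, map_mul, map_mul, X.i_smul]
    have h2 := X.i_delta a g h
    have c1 := X.central (X.delta a (g, h)) β⁻¹
    have c2 : ∀ y : B, g • X.i (u h) * y = y * g • X.i (u h) := fun y => by
      rw [← X.i_smul, X.central]
    simp only [smul_mul', mul_smul, smul_inv']
    calc _ = X.i (u g) * β⁻¹ * X.lift a.1 g * (g • β * g • X.i (u h)) * (g • β)⁻¹ *
              g • X.lift a.1 h * g • h • β := by simp only [mul_assoc]
      _ = X.i (u g) * β⁻¹ * (X.lift a.1 g * g • X.i (u h)) * g • X.lift a.1 h * g • h • β := by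
          rw [← c2]; simp [mul_assoc]
      _ = X.i (u g) * (β⁻¹ * g • X.i (u h)) * (X.lift a.1 g * g • X.lift a.1 h) * g • h • β := by
          rw [← c2]; simp only [mul_assoc]
      _ = (X.i (u g) * g • X.i (u h)) * (β⁻¹ * X.i (X.delta a (g, h))) *
            X.lift a.1 (g * h) * g • h • β := by
          rw [← c2, ← h2]; simp only [mul_assoc]
      _ = ((X.i (u g) * g • X.i (u h)) * X.i (X.delta a (g, h))) * β⁻¹ *
            X.lift a.1 (g * h) * g • h • β := by
          rw [← c1]; simp only [mul_assoc]
      _ = _ := by rw [← X.central]; simp only [mul_assoc]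
  change g • u h / u (g * h) * u g = (X.delta a (g, h))⁻¹ * X.delta a' (g, h)
  rw [eq_inv_mul_iff_mul_eq, div_eq_mul_inv, ← mul_inv_eq_iff_eq_mul.2 e.symm]
  simp only [mul_assoc, mul_left_comm, mul_comm]

/-- The connecting map `H¹(G, C) → H²(G, A)`. -/
def connecting : NH1 G C → H2 G A :=
  Quotient.lift X.deltaZ fun _ _ h => X.deltaZ_eq h

end CentralExt

end Connecting

/-! ### Galois action on `GL₂` and `PGL₂`, and the extension `1 → 𝔾ₘ → GL₂ → PGL₂ → 1` -/

section PGL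

open Matrix

variable {K L : Type*} [Field K] [Field L] [Algebra K L]

/-- Entrywise Galois action on `GL₂(L)`. -/
instance galGL : MulDistribMulAction Gal(L/K) (GL (Fin 2) L) where
  smul g A := GeneralLinearGroup.map (g : L →+* L) A
  one_smul A := by ext; rfl
  mul_smul g h A := by ext; rfl
  smul_one g := map_one _
  smul_mul g A B := map_mul _ A B

lemma galGL_apply (g : Gal(L/K)) (A : GL (Fin 2) L) (i j : Fin 2) :
    (g • A : GL (Fin 2) L).1 i j = g (A.1 i j) := rfl

lemma galGL_scalar (g : Gal(L/K)) (u : Lˣ) :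
    g • GeneralLinearGroup.scalar (Fin 2) u = GeneralLinearGroup.scalar (Fin 2) (g • u) :=
  GeneralLinearGroup.map_scalar _ u

/-- The action of one Galois element on `PGL₂(L)`, induced from `GL₂(L)`. -/
def galPGLHom (g : Gal(L/K)) : PGL(2, L) →* PGL(2, L) :=
  QuotientGroup.map _ _ (MulDistribMulAction.toMonoidHom (GL (Fin 2) L) g) (by
    intro A hA
    rw [GeneralLinearGroup.center_eq_range_scalar] at hA
    obtain ⟨u, rfl⟩ := hA
    simp only [Subgroup.mem_comap, MulDistribMulAction.toMonoidHom_apply, galGL_scalar,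
      GeneralLinearGroup.center_eq_range_scalar]
    exact ⟨_, rfl⟩)

/-- Galois action on `PGL₂(L)`. -/
instance galPGL : MulDistribMulAction Gal(L/K) (PGL(2, L)) where
  smul g A := galPGLHom g A
  one_smul A := by
    obtain ⟨A, rfl⟩ := ProjGenLinGroup.mk_surjective A
    exact congrArg ProjGenLinGroup.mk (one_smul Gal(L/K) A)
  mul_smul g h A := by
    obtain ⟨A, rfl⟩ := ProjGenLinGroup.mk_surjective A
    exact congrArg ProjGenLinGroup.mk (mul_smul g h A)
  smul_one g := map_one _
  smul_mul g A B := map_mul _ A B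

lemma galPGL_mk (g : Gal(L/K)) (A : GL (Fin 2) L) :
    g • ProjGenLinGroup.mk A = ProjGenLinGroup.mk (g • A) := rfl

variable (K L) in
/-- The central extension `1 → Lˣ → GL₂(L) → PGL₂(L) → 1` of `Gal(L/K)`-groups. -/
def pglExt [Algebra.IsIntegral K L] : CentralExt Gal(L/K) Lˣ (GL (Fin 2) L) (PGL(2, L)) where
  i := GeneralLinearGroup.scalar (Fin 2)
  p := ProjGenLinGroup.mk
  i_smul g a := (galGL_scalar g a).symm
  p_smul g b := (galPGL_mk g b).symm
  inj a b h := by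
    have := congrArg (fun A : GL (Fin 2) L => A.1 0 0) h
    exact Units.ext (by simpa using this)
  surj := ProjGenLinGroup.mk_surjective
  exact b := by
    rw [ProjGenLinGroup.mk_eq_one, GeneralLinearGroup.center_eq_range_scalar]
    rfl
  central a b := by
    have : GeneralLinearGroup.scalar (Fin 2) a ∈ Subgroup.center (GL (Fin 2) L) := by
      rw [GeneralLinearGroup.center_eq_range_scalar]
      exact ⟨a, rfl⟩
    exact (Subgroup.mem_center_iff.1 this b).symm
  smooth b := by
    rw [IsLocallyConstant.iff_eventually_eq]
    intro g
    have key : ∀ x : L, ∀ᶠ h : Gal(L/K) in 𝓝 g, h x = g x := by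
      intro x
      have h1 : ∀ᶠ s : Gal(L/K) in 𝓝 1, s ∈ MulAction.stabilizer Gal(L/K) x :=
        (stabilizer_isOpen_of_isIntegral (K := K) x).mem_nhds (one_mem _)
      have h2 : Filter.Tendsto (fun h : Gal(L/K) => g⁻¹ * h) (𝓝 g) (𝓝 1) := by
        have := (continuous_const_mul g⁻¹).tendsto g
        rwa [inv_mul_cancel] at this
      filter_upwards [h2.eventually h1] with h hh
      have h3 : (g⁻¹ * h) • x = x := hh
      rw [mul_smul, inv_smul_eq_iff] at h3
      exact h3
    filter_upwards [key (b.1 0 0), key (b.1 0 1), key (b.1 1 0), key (b.1 1 1)] with h h1 h2 h3 h4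
    ext i j
    fin_cases i <;> fin_cases j <;> simpa [galGL_apply]

end PGL

/-! ### The 2-torsion of an elliptic curve and its action on `ℙ¹ = E / ±1` -/

section Elliptic

open Matrix WeierstrassCurve

variable {L : Type*} [Field L]

/-- The degree two map `E → ℙ¹` given by the linear system `|2∞|`, i.e. the `x`-coordinate. -/
def xLine {W : WeierstrassCurve L} (P : W.toAffine.Point) : ℙ L (Fin 2 → L) :=
  Projectivization.mk L P.xRep P.xRep_ne_zero

/-- The automorphism `g` of `ℙ¹` is induced by the translation `R ↦ P + R` of `E`. -/
def IsTranslation {W : WeierstrassCurve L} (P : W.toAffine.Point) (g : PGL(2, L)) : Prop :=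
  ∀ R : W.toAffine.Point, g • xLine R = xLine (P + R)

lemma isTranslation_mk {W : WeierstrassCurve L} (P : W.toAffine.Point) (A : GL (Fin 2) L) :
    IsTranslation P (ProjGenLinGroup.mk A) ↔
      ∀ R : W.toAffine.Point, ∃ u : Lˣ, u • (P + R).xRep = A.1 *ᵥ R.xRep := by
  refine forall_congr' fun R => ?_
  rw [xLine, xLine, Projectivization.PGL.mk_smul_mk, Projectivization.mk_eq_mk_iff]
  rfl

/-- Translation by a 2-torsion point descends to `ℙ¹`. -/
lemma exists_isTranslation {W : WeierstrassCurve L} [W.IsElliptic] (P : W.toAffine.Point)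
    (hP : P + P = 0) : ∃ g, IsTranslation P g := by
  rcases P with _ | ⟨α, y₀, hns⟩
  · refine ⟨1, fun R => ?_⟩
    rw [one_smul]
    change xLine R = xLine (0 + R)
    rw [zero_add]
  have hy : 2 * y₀ + W.a₁ * α + W.a₃ = 0 := by
    have h := (Affine.Point.some.injEq ..).mp (eq_neg_of_add_eq_zero_left hP)
    have h2 := h.2
    simp only [Affine.negY] at h2
    linear_combination h2
  have heq := (Affine.equation_iff _ _).1 hns.1
  have hdet : 3 * α ^ 2 + 2 * W.a₂ * α + W.a₄ - W.a₁ * y₀ ≠ 0 := by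
    rcases ((Affine.nonsingular_iff' _ _).1 hns).2 with h | h
    · intro h0; apply h; linear_combination -h0
    · exact absurd hy h
  let M : Matrix (Fin 2) (Fin 2) L :=
    !![α, 2 * α ^ 2 + 2 * W.a₂ * α + W.a₄ - W.a₁ * y₀; 1, -α]
  have hM : M.det ≠ 0 := by
    simp only [M, det_fin_two_of]
    intro h0; apply hdet; linear_combination -h0
  refine ⟨ProjGenLinGroup.mk (GeneralLinearGroup.mkOfDetNeZero M hM), ?_⟩
  rw [isTranslation_mk]
  intro R
  change ∃ u : Lˣ, u • (Affine.Point.some α y₀ hns + R).xRep = M *ᵥ R.xRep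
  rcases R with _ | ⟨x, y, hR⟩
  · refine ⟨1, ?_⟩
    change (1 : Lˣ) • (Affine.Point.some α y₀ hns + 0).xRep = M *ᵥ Affine.Point.xRep 0
    rw [add_zero, one_smul]
    ext i
    fin_cases i <;> simp [M]
  have hReq := (Affine.equation_iff _ _).1 hR.1
  by_cases hx : x = α
  · subst hx
    have hyy : y = y₀ := by
      have h : (y - y₀) ^ 2 = 0 := by
        linear_combination hReq - heq - (y - y₀) * hy
      exact sub_eq_zero.1 (pow_eq_zero_iff two_ne_zero |>.1 h)
    subst hyy
    rw [hP]
    refine ⟨Units.mk0 _ hdet, ?_⟩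
    ext i
    fin_cases i
    · simp [M, Units.smul_def]; ring
    · simp [M]
  · have hx' : x - α ≠ 0 := sub_ne_zero.2 hx
    have hx'' : α - x ≠ 0 := sub_ne_zero.2 (Ne.symm hx)
    refine ⟨Units.mk0 _ hx', ?_⟩
    rw [Affine.Point.add_some (fun h => hx h.1.symm), Affine.Point.xRep_some, Affine.Point.xRep_some,
      Affine.slope_of_X_ne (Ne.symm hx)]
    ext i
    fin_cases i
    · simp [M, Units.smul_def, Affine.addX]
      field_simp
      linear_combination (x - α) * (hReq - heq + (y₀ - y) * hy)
    · simp [M, Units.smul_def, sub_eq_add_neg]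

/-- Every `x ∈ L` is the `x`-coordinate of a point if `L` is algebraically closed. -/
lemma exists_point [IsAlgClosed L] (W : WeierstrassCurve L) [W.IsElliptic] (x : L) :
    ∃ R : W.toAffine.Point, R.xRep = ![x, 1] := by
  obtain ⟨y, hy⟩ := IsAlgClosed.exists_root
    (Polynomial.C 1 * Polynomial.X ^ 2 + Polynomial.C (W.a₁ * x + W.a₃) * Polynomial.X +
      Polynomial.C (-(x ^ 3 + W.a₂ * x ^ 2 + W.a₄ * x + W.a₆)))
    (by rw [Polynomial.degree_quadratic one_ne_zero]; decide)
  have h : W.toAffine.Equation x y := by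
    rw [Affine.equation_iff]
    simp at hy
    linear_combination hy
  exact ⟨.some x y (Affine.equation_iff_nonsingular.1 h), rfl⟩

/-- The automorphism of `ℙ¹` induced by a translation is unique. -/
lemma IsTranslation.unique [IsAlgClosed L] {W : WeierstrassCurve L} [W.IsElliptic]
    {P : W.toAffine.Point} {g g' : PGL(2, L)} (h : IsTranslation P g) (h' : IsTranslation P g') :
    g = g' := by
  have hfix : IsTranslation (0 : W.toAffine.Point) (g'⁻¹ * g) := by
    intro R
    rw [mul_smul, h R, ← h' R, inv_smul_smul, zero_add]
  refine (inv_mul_eq_one.1 ?_).symm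
  obtain ⟨A, hA⟩ := ProjGenLinGroup.mk_surjective (g'⁻¹ * g)
  rw [← hA, isTranslation_mk] at hfix
  rw [← hA, ProjGenLinGroup.mk_eq_one, GeneralLinearGroup.mem_center_iff_val_mem_range_scalar]
  obtain ⟨u, hu⟩ := hfix 0
  obtain ⟨R0, hR0⟩ := exists_point W 0
  obtain ⟨R1, hR1⟩ := exists_point W 1
  obtain ⟨v, hv⟩ := hfix R0
  obtain ⟨w, hw⟩ := hfix R1
  rw [zero_add] at hu hv hw
  rw [hR0] at hv
  rw [hR1] at hw
  have u0 := congrFun hu 0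
  have u1 := congrFun hu 1
  have v0 := congrFun hv 0
  have v1 := congrFun hv 1
  have w0 := congrFun hw 0
  have w1 := congrFun hw 1
  simp [Units.smul_def, mulVec, dotProduct, Fin.sum_univ_two] at u0 u1 v0 v1 w0 w1
  refine ⟨(u : L), ?_⟩
  ext i j
  fin_cases i <;> fin_cases j
  · simpa using u0
  · simpa using v0
  · simpa using u1
  · simp
    linear_combination u0 - w0 + w1 + v0 - u1

end Elliptic
/-! ### The quadratic form `H¹(K, E[2]) → H²(K, 𝔾ₘ)` -/

section Form

open Matrix WeierstrassCurve

variable {K : Type*} [Field K] (W : WeierstrassCurve K) (L : Type*) [Field L] [Algebra K L]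

/-- `E[2](L)`. -/
abbrev E2 : Type _ := AddSubgroup.torsionBy (W.baseChange L).toAffine.Point ((2 : ℕ) : ℤ)

instance : Module (ZMod 2) (E2 W L) := AddSubgroup.torsionBy.zmodModule

/-- The Galois action on `E(L)`. -/
def galPoint (g : Gal(L/K)) :
    (W.baseChange L).toAffine.Point →+ (W.baseChange L).toAffine.Point :=
  Affine.Point.map (W' := W) (S := K) (g : L →ₐ[K] L)

lemma galPoint_one (P : (W.baseChange L).toAffine.Point) : galPoint W L 1 P = P := by
  cases P <;> rfl

lemma galPoint_mul (g h : Gal(L/K)) (P : (W.baseChange L).toAffine.Point) :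
    galPoint W L (g * h) P = galPoint W L g (galPoint W L h P) := by
  cases P <;> rfl

/-- The Galois representation `E[2]` over `𝔽₂`. -/
def galE2 : Representation (ZMod 2) Gal(L/K) (E2 W L) where
  toFun g := AddMonoidHom.toZModLinearMap 2
    (((galPoint W L g).comp (AddSubgroup.subtype _)).codRestrict _ (fun P => by
      have h := AddSubgroup.torsionBy.nsmul_iff.1 P.2
      rw [AddSubgroup.torsionBy.nsmul_iff]
      change 2 • galPoint W L g P.1 = 0
      rw [← map_nsmul, h, map_zero]))
  map_one' := LinearMap.ext fun P => Subtype.ext (galPoint_one W L P.1)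
  map_mul' g h := LinearMap.ext fun P => Subtype.ext (galPoint_mul W L g h P.1)

variable {W L}

lemma galPoint_xRep (g : Gal(L/K)) (P : (W.baseChange L).toAffine.Point) (i : Fin 2) :
    (galPoint W L g P).xRep i = g (P.xRep i) := by
  rcases P with _ | ⟨x, y, h⟩
  · change Affine.Point.xRep 0 i = g (Affine.Point.xRep 0 i)
    fin_cases i <;> simp
  · change ![g x, 1] i = g (![x, 1] i)
    fin_cases i <;> simp

lemma galPoint_inv (g : Gal(L/K)) (P : (W.baseChange L).toAffine.Point) :
    galPoint W L g (galPoint W L g⁻¹ P) = P := by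
  rw [← galPoint_mul, mul_inv_cancel, galPoint_one]

lemma IsTranslation.gal {P : (W.baseChange L).toAffine.Point} {A : PGL(2, L)}
    (h : IsTranslation P A) (g : Gal(L/K)) : IsTranslation (galPoint W L g P) (g • A) := by
  obtain ⟨A, rfl⟩ := ProjGenLinGroup.mk_surjective A
  rw [isTranslation_mk] at h
  rw [galPGL_mk, isTranslation_mk]
  intro R
  obtain ⟨u, hu⟩ := h (galPoint W L g⁻¹ R)
  refine ⟨g • u, ?_⟩
  ext i
  have := congrArg g (congrFun hu i)
  simp only [Pi.smul_apply, Units.smul_def, smul_eq_mul, map_mul, ← galPoint_xRep, map_add,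
    galPoint_inv, mulVec, dotProduct, map_sum] at this
  simp only [Pi.smul_apply, Units.smul_def, smul_eq_mul, mulVec, dotProduct, galGL_apply]
  exact this

lemma IsTranslation.add {V : WeierstrassCurve L} {P P' : V.toAffine.Point} {A A' : PGL(2, L)}
    (h : IsTranslation P A) (h' : IsTranslation P' A') : IsTranslation (P + P') (A * A') := by
  intro R
  rw [mul_smul, h', h, add_assoc]

instance baseChange_isElliptic [W.IsElliptic] : (W.baseChange L).IsElliptic :=
  inferInstanceAs (W.map (algebraMap K L)).IsElliptic

lemma E2.add_self (P : E2 W L) : P.1 + P.1 = 0 := by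
  rw [← two_nsmul]
  exact AddSubgroup.torsionBy.nsmul_iff.1 P.2

variable [W.IsElliptic] [IsAlgClosed L]

variable (W L) in
/-- The homomorphism `E[2] → PGL₂`: the action of `E[2]` on `ℙ¹` by translations. -/
def theta : Multiplicative (E2 W L) →* PGL(2, L) where
  toFun P := (exists_isTranslation (P.toAdd : E2 W L).1 (E2.add_self P.toAdd)).choose
  map_one' := IsTranslation.unique (Exists.choose_spec _) (fun R => by
    rw [one_smul]
    exact congrArg xLine (zero_add R).symm)
  map_mul' P P' := IsTranslation.unique (Exists.choose_spec _)
    (IsTranslation.add (Exists.choose_spec _) (Exists.choose_spec _))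

lemma theta_isTranslation (P : E2 W L) : IsTranslation P.1 (theta W L (.ofAdd P)) :=
  (exists_isTranslation P.1 (E2.add_self P)).choose_spec

lemma theta_gal (g : Gal(L/K)) (P : E2 W L) :
    theta W L (.ofAdd (galE2 W L g P)) = g • theta W L (.ofAdd P) :=
  (theta_isTranslation _).unique ((theta_isTranslation P).gal g)

variable (W L) in
/-- The map `H¹(K, E[2]) → H¹(K, PGL₂)` induced by `theta`. -/
def toPGL : H1 (galE2 W L) → NH1 Gal(L/K) (PGL(2, L)) :=
  Quotient.map' (fun c => ⟨fun g => theta W L (.ofAdd (c.1 g)), c.2.1.comp _, fun g h => by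
      change theta W L (.ofAdd (c.1 (g * h))) = _
      rw [c.2.2, ofAdd_add, map_mul, theta_gal]⟩) (by
    intro a b hab
    rw [Submodule.quotientRel_def] at hab
    obtain ⟨m, hm⟩ := hab
    refine ⟨(theta W L (.ofAdd m))⁻¹, fun g => ?_⟩
    have h1 : b.1 g = m + a.1 g - galE2 W L g m := by
      have := congrFun hm g
      simp only [LinearMap.pi_apply, LinearMap.sub_apply, LinearMap.id_apply] at this
      have h2 : galE2 W L g m - m = a.1 g - b.1 g := this
      have h3 : b.1 g = a.1 g - (galE2 W L g m - m) := by rw [h2]; abel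
      rw [h3]; abel
    change theta W L (.ofAdd (b.1 g)) = _ * theta W L (.ofAdd (a.1 g)) * _
    rw [h1, sub_eq_add_neg, ofAdd_add, ofAdd_add, ofAdd_neg, map_mul, map_mul, map_inv, theta_gal,
      smul_inv', inv_inv])

variable (W L) in
/-- The composite `H¹(K, E[2]) → H¹(K, PGL₂) → H²(K, 𝔾ₘ)`; the target is written
multiplicatively. -/
def obstruction [Algebra.IsIntegral K L] (c : H1 (galE2 W L)) : H2 Gal(L/K) Lˣ :=
  (pglExt K L).connecting (toPGL W L c)

variable (W L) in
/-- `obstruction` takes values in `H²(K, 𝔾ₘ)[2]`. When `K` is a nonarchimedean local field this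
group has exactly two elements, and this is the composite of `obstruction` with the unique
isomorphism `H²(K, 𝔾ₘ)[2] ≃ ℤ/2ℤ`. -/
def formF2 [Algebra.IsIntegral K L] (c : H1 (galE2 W L)) : ZMod 2 :=
  if obstruction W L c = 1 then 0 else 1

end Form

/-! ### Extension of scalars to a field `k` of characteristic two -/

section Scalars

variable {K : Type*} [Field K] (W : WeierstrassCurve K) (L : Type*) [Field L] [Algebra K L]
  (k : Type*) [Field k] [Algebra (ZMod 2) k]

/-- The Galois representation `V = E[2] ⊗ k`. -/
def galV : Representation k Gal(L/K) (k ⊗[ZMod 2] E2 W L) where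
  toFun g := (galE2 W L g).baseChange k
  map_one' := by rw [map_one]; exact LinearMap.baseChange_id
  map_mul' g h := by rw [map_mul]; exact LinearMap.baseChange_mul _ _

/-- The map `H¹(K, E[2]) → H¹(K, V)` induced by `P ↦ 1 ⊗ P`. -/
def scalarMap : H1 (galE2 W L) →ₛₗ[algebraMap (ZMod 2) k] H1 (galV W L k) :=
  H1.map _ _
    { toFun := fun P => (1 : k) ⊗ₜ[ZMod 2] P
      map_add' := fun P P' => TensorProduct.tmul_add _ _ _
      map_smul' := fun a P => by
        rw [TensorProduct.tmul_smul, algebraMap_smul] }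
    (fun g P => (LinearMap.baseChange_tmul _ _ _).symm)

/-- `Q` is the quadratic form on `H¹(K, V)` obtained from `formF2` by extending scalars from
`𝔽₂` to `k`. As the image of `H¹(K, E[2])` spans `H¹(K, V) = H¹(K, E[2]) ⊗ k` over `k`, a
quadratic form is determined by its values on that image. -/
def IsScalarExtension [W.IsElliptic] [IsAlgClosed L] [Algebra.IsIntegral K L]
    (Q : QuadraticForm k (H1 (galV W L k))) : Prop :=
  ∀ c : H1 (galE2 W L), Q (scalarMap W L k c) = algebraMap (ZMod 2) k (formF2 W L c)

end Scalars

/-! ### Primes of good reduction and Frobenius elements -/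

/-- `E` has good reduction at `w`, i.e. `w` does not divide the conductor of `E`. -/
def GoodReductionAt (E : WeierstrassCurve ℚ) (w : ℕ) [Fact w.Prime] : Prop :=
  ((E.baseChange ℚ_[w]).minimal ℤ_[w]).HasGoodReduction ℤ_[w]

/-- `φ ∈ Gal(ℚ̄/ℚ)` is a Frobenius element at `w`: for some embedding `ι : ℚ̄ → ℚ̄_w` it is the
restriction of some `σ ∈ Gal(ℚ̄_w/ℚ_w)` which induces `x ↦ x ^ w` on the residue field. -/
def IsFrobenius (w : ℕ) [Fact w.Prime] (φ : Gal(AlgebraicClosure ℚ/ℚ)) : Prop :=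
  ∃ (ι : AlgebraicClosure ℚ →ₐ[ℚ] PadicAlgCl w) (σ : Gal(PadicAlgCl w/ℚ_[w])),
    (∀ x : PadicAlgCl w, ‖x‖ ≤ 1 → ‖σ x - x ^ w‖ < 1) ∧ ∀ x, ι (φ x) = σ (ι x)

end GalCoh

end

noncomputable section

namespace GalCoh

/-! ### Coboundaries in terms of elements. -/

section CohomologyClasses

variable {k G M : Type*} [CommRing k] [Group G] [TopologicalSpace G]
  [AddCommGroup M] [Module k M]

/-! Write the 2-division polynomial as `4f` with `f = (X - α)(X - β)(X - γ)`. The neighbourhood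
consists of the automorphisms fixing the roots of `f` and chosen square roots of their differences.
If the square of a Frobenius `σ` lies in it, `σ` acts on the three roots with square one, so it
fixes one of them, say `α`. At an odd prime of good reduction the roots can be normalized to be
integral and pairwise incongruent, so a root fixed by `σ` is fixed by the whole decomposition group
(`gal_root_eq`). If `σ` fixed all three, `E[2]` would be a trivial module and `H¹` too large
(`finrank_H1_ne_two_of_trivial`). Hence `σ` swaps `β` and `γ`, and the action on `E[2]` is
unipotent, given by the quadratic character `ψ` of `β - γ`. The unique stable line is spanned by the
point `P` over `α`.

Since `w` is odd, the continuous characters with values in `𝔽₂` are spanned by `ψ` and the character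
`χ` of a square root of `w` (`padic_quadChar_span`). The cocycle `ψ • P` is the coboundary of the
point over `β`, while `χ • P` is not a coboundary, so the image of `H¹` of the line is spanned by
the class of `χ • P` (`IsUnipotent.imageOfSub_line`).

Translation by `P` acts on `ℙ¹` as `x ↦ α + f'(α)/(x - α)`. If `f'(α) = t²` with `t` rational, it is
induced by a rational matrix of square one, so `χ • P` lifts to a cocycle in `GL₂` and its
obstruction vanishes (`obstruction_charCocycle`). The condition on `σ²` provides `t`: if `s² = α -
β`, then `(σ s)² = α - γ`, and `t = s * σ s` is fixed by `σ` because `σ² s = s`. Up to a factor in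
`ℚ_w` it is a unit, so it is fixed by the whole group.

The quadratic form itself costs little: `H¹(V)` is the extension of scalars of `H¹(E[2])`, and on a
plane over `𝔽₂` any function vanishing at `0` is quadratic (`existsUnique_quadraticForm`). -/

lemma H1.mk_eq_zero_iff {ρ : Representation k G M} (c : Z1 ρ) :
    (Submodule.Quotient.mk c : H1 ρ) = 0 ↔ ∃ m, ∀ g, ρ g m - m = c.1 g := by
  rw [Submodule.Quotient.mk_eq_zero]
  constructor
  · rintro ⟨m, hm⟩
    exact ⟨m, fun g => congrFun hm g⟩
  · rintro ⟨m, hm⟩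
    exact ⟨m, funext hm⟩

end CohomologyClasses

/-! ### `H¹(K, V) = H¹(K, E[2]) ⊗ k` -/

section ScalarExtension

variable {K : Type*} [Field K] (W : WeierstrassCurve K) (L : Type*) [Field L] [Algebra K L]
  {k : Type*} [Field k] [Algebra (ZMod 2) k]

/-- The contraction `k ⊗ E[2] → E[2]` along a functional `k → 𝔽₂`. -/
def contract (f : k →ₗ[ZMod 2] ZMod 2) : k ⊗[ZMod 2] E2 W L →ₗ[ZMod 2] E2 W L :=
  (TensorProduct.lid (ZMod 2) (E2 W L)).toLinearMap ∘ₗ f.rTensor (E2 W L)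

@[simp] lemma contract_tmul (f : k →ₗ[ZMod 2] ZMod 2) (a : k) (P : E2 W L) :
    contract W L f (a ⊗ₜ P) = f a • P := by
  simp [contract]

lemma contract_galV (f : k →ₗ[ZMod 2] ZMod 2) (g : Gal(L/K)) (v : k ⊗[ZMod 2] E2 W L) :
    contract W L f (galV W L k g v) = galE2 W L g (contract W L f v) := by
  induction v with
  | zero => simp
  | add x y hx hy => simp only [map_add, hx, hy]
  | tmul a P =>
    have : galV W L k g (a ⊗ₜ P) = a ⊗ₜ galE2 W L g P := LinearMap.baseChange_tmul _ _ _
    rw [this, contract_tmul, contract_tmul, map_smul]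

/-- The contraction of a cocycle along a functional `k → 𝔽₂`. -/
def contractZ (f : k →ₗ[ZMod 2] ZMod 2) (c : Z1 (galV W L k)) : Z1 (galE2 W L) :=
  ⟨fun g => contract W L f (c.1 g), c.2.1.comp _, fun g h => by
    change contract W L f (c.1 (g * h)) =
      contract W L f (c.1 g) + galE2 W L g (contract W L f (c.1 h))
    rw [c.2.2, map_add, contract_galV]⟩

/-- On a pure tensor this is the expansion of the scalar in the basis. It splits a cocycle with
values in `V` into cocycles with values in `E[2]`. -/
lemma sum_smul_contract {ι : Type*} [Fintype ι] (b : Module.Basis ι (ZMod 2) k)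
    (v : k ⊗[ZMod 2] E2 W L) :
    ∑ i, b i • ((1 : k) ⊗ₜ[ZMod 2] contract W L (b.coord i) v) = v := by
  induction v with
  | zero => simp
  | add x y hx hy =>
    simp only [map_add, TensorProduct.tmul_add, smul_add, Finset.sum_add_distrib, hx, hy]
  | tmul a P =>
    have h (i : ι) : b i • ((1 : k) ⊗ₜ[ZMod 2] contract W L (b.coord i) (a ⊗ₜ P)) =
        (b.repr a i • b i) ⊗ₜ P := by
      rw [contract_tmul, TensorProduct.smul_tmul', smul_eq_mul, mul_one, TensorProduct.smul_tmul,
        Module.Basis.coord_apply]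
    simp only [h]
    rw [← TensorProduct.sum_tmul, b.sum_repr]

lemma scalarMap_mk (c : Z1 (galE2 W L)) :
    scalarMap W L k (Submodule.Quotient.mk c) = Submodule.Quotient.mk
      (Z1.map (galE2 W L) (galV W L k) (σ := algebraMap (ZMod 2) k)
        { toFun := fun P => (1 : k) ⊗ₜ[ZMod 2] P
          map_add' := fun P P' => TensorProduct.tmul_add _ _ _
          map_smul' := fun a P => by
            rw [TensorProduct.tmul_smul, algebraMap_smul] }
        (fun g P => (LinearMap.baseChange_tmul _ _ _).symm) c) := rfl

lemma span_range_scalarMap [Finite k] :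
    Submodule.span k (Set.range (scalarMap W L k)) = ⊤ := by
  have : Module.Finite (ZMod 2) k := Module.Finite.of_finite
  let b := Module.finBasis (ZMod 2) k
  rw [eq_top_iff]
  rintro x -
  obtain ⟨c, rfl⟩ := Submodule.Quotient.mk_surjective _ x
  have hc : (Submodule.Quotient.mk c : H1 (galV W L k)) =
      ∑ i, b i • scalarMap W L k (Submodule.Quotient.mk (contractZ W L (b.coord i) c)) := by
    simp only [scalarMap_mk, ← Submodule.Quotient.mk_smul]
    rw [← Submodule.mkQ_apply]
    simp only [← Submodule.mkQ_apply]
    rw [← map_sum]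
    congr 1
    ext g
    rw [AddSubmonoidClass.coe_finsetSum, Finset.sum_apply]
    exact (sum_smul_contract W L b (c.1 g)).symm
  rw [hc]
  exact Submodule.sum_mem _ fun i _ => Submodule.smul_mem _ _ (Submodule.subset_span ⟨_, rfl⟩)

/-- Contracting a relation over `k`, together with the element whose coboundary it is, along a
functional `f : k → 𝔽₂` gives a relation over `𝔽₂` with coefficients `f (a i)`. Functionals separate
the elements of `k`. -/
lemma linearIndependent_scalarMap {ι : Type*} {e : ι → H1 (galE2 W L)}
    (he : LinearIndependent (ZMod 2) e) :
    LinearIndependent k fun i => scalarMap W L k (e i) := by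
  rw [linearIndependent_iff'] at he ⊢
  intro s a ha i hi
  choose z hz using fun i => Submodule.Quotient.mk_surjective _ (e i)
  simp only [← hz, scalarMap_mk, ← Submodule.Quotient.mk_smul] at ha
  simp only [← Submodule.mkQ_apply] at ha
  rw [← map_sum, Submodule.mkQ_apply, H1.mk_eq_zero_iff] at ha
  obtain ⟨m, hm⟩ := ha
  rw [← Module.forall_dual_apply_eq_zero_iff (ZMod 2)]
  intro f
  refine he s (fun i => f (a i)) ?_ i hi
  simp only [← hz, ← Submodule.Quotient.mk_smul]
  simp only [← Submodule.mkQ_apply]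
  rw [← map_sum, Submodule.mkQ_apply, H1.mk_eq_zero_iff]
  refine ⟨contract W L f m, fun g => ?_⟩
  rw [← contract_galV, ← map_sub, hm g, AddSubmonoidClass.coe_finsetSum,
    AddSubmonoidClass.coe_finsetSum, Finset.sum_apply, Finset.sum_apply, map_sum]
  refine Finset.sum_congr rfl fun j _ => ?_
  change contract W L f (a j • ((1 : k) ⊗ₜ (z j).1 g)) = f (a j) • (z j).1 g
  rw [TensorProduct.smul_tmul', contract_tmul, smul_eq_mul, mul_one]

/-- The `k`-basis of `H¹(K, V)` obtained from an `𝔽₂`-basis of `H¹(K, E[2])`. -/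
def scalarBasis [Finite k] {ι : Type*} (b : Module.Basis ι (ZMod 2) (H1 (galE2 W L))) :
    Module.Basis ι k (H1 (galV W L k)) :=
  .mk (linearIndependent_scalarMap W L b.linearIndependent) (by
    rw [← span_range_scalarMap, Submodule.span_le]
    rintro _ ⟨c, rfl⟩
    have h := b.mem_span c
    induction h using Submodule.span_induction with
    | mem x hx =>
      obtain ⟨i, rfl⟩ := hx
      exact Submodule.subset_span ⟨i, rfl⟩
    | zero => rw [map_zero]; exact Submodule.zero_mem _
    | add x y _ _ hx hy => rw [map_add]; exact Submodule.add_mem _ hx hy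
    | smul a x _ hx => rw [LinearMap.map_smulₛₗ]; exact Submodule.smul_mem _ _ hx)

@[simp] lemma scalarBasis_apply [Finite k] {ι : Type*}
    (b : Module.Basis ι (ZMod 2) (H1 (galE2 W L))) (i : ι) :
    scalarBasis W L (k := k) b i = scalarMap W L k (b i) := by
  simp [scalarBasis]

/-- Both ranks are the `Nat.card` of one index type, so finite dimensionality need not be known
beforehand. It can therefore be deduced over `𝔽₂` from the rank over `k`. -/
lemma finrank_H1_galV [Finite k] :
    Module.finrank k (H1 (galV W L k)) = Module.finrank (ZMod 2) (H1 (galE2 W L)) := by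
  let b := Module.Free.chooseBasis (ZMod 2) (H1 (galE2 W L))
  rw [Module.finrank_eq_nat_card_basis b, Module.finrank_eq_nat_card_basis (scalarBasis W L b)]

lemma scalarMap_injective : Function.Injective (scalarMap W L k) := by
  rw [injective_iff_map_eq_zero]
  intro c hc
  by_contra h
  have := linearIndependent_scalarMap W L (k := k) (e := fun _ : Unit => c)
    (LinearIndependent.of_subsingleton () h)
  exact this.ne_zero () hc

end ScalarExtension

lemma ZMod.eq_zero_or_one (a : ZMod 2) : a = 0 ∨ a = 1 := by
  revert a; decide

/-- On a two-dimensional space over `𝔽₂` every function vanishing at `0` is a quadratic form, and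
it extends uniquely to an extension of scalars. -/
lemma existsUnique_quadraticForm {k M N : Type*} [Field k] [AddCommGroup M]
    [Module (ZMod 2) M] [AddCommGroup N] [Module k N] (b : Module.Basis (Fin 2) (ZMod 2) M)
    (b' : Module.Basis (Fin 2) k N) {a : ZMod 2 →+* k} (s : M →ₛₗ[a] N)
    (hs : ∀ i, s (b i) = b' i) (q : M → ZMod 2) (hq : q 0 = 0) :
    ∃! Q : QuadraticForm k N, ∀ m, Q (s m) = a (q m) := by
  have hM : ∀ m : M, m = 0 ∨ m = b 0 ∨ m = b 1 ∨ m = b 0 + b 1 := by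
    intro m
    have h := b.sum_repr m
    rw [Fin.sum_univ_two] at h
    rcases ZMod.eq_zero_or_one (b.repr m 0) with h0 | h0 <;>
      rcases ZMod.eq_zero_or_one (b.repr m 1) with h1 | h1 <;>
        simp only [h0, h1, zero_smul, one_smul, zero_add, add_zero] at h <;> simp [← h]
  -- The diagonal coefficients are the values on the basis and the mixed one is the polar form. Any
  -- extension must have these coefficients, and `M` has only the four vectors of `hM` on which to
  -- check them.
  refine ⟨a (q (b 0)) • QuadraticMap.linMulLin (b'.coord 0) (b'.coord 0) +
    a (q (b 1)) • QuadraticMap.linMulLin (b'.coord 1) (b'.coord 1) +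
    a (q (b 0 + b 1) - q (b 0) - q (b 1)) • QuadraticMap.linMulLin (b'.coord 0) (b'.coord 1),
    ?_, ?_⟩
  · intro m
    rcases hM m with rfl | rfl | rfl | rfl <;> simp [hs, hq]
  · intro Q hQ
    have h0 := hQ (b 0)
    have h1 := hQ (b 1)
    have h2 := hQ (b 0 + b 1)
    rw [hs] at h0 h1
    rw [map_add, hs, hs, QuadraticMap.map_add Q, h0, h1] at h2
    ext v
    have hv := b'.sum_repr v
    rw [Fin.sum_univ_two] at hv
    conv_lhs => rw [← hv]
    rw [QuadraticMap.map_add Q, QuadraticMap.map_smul, QuadraticMap.map_smul,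
      QuadraticMap.polar_smul_left, QuadraticMap.polar_smul_right, h0, h1]
    have h3 : QuadraticMap.polar Q (b' 0) (b' 1) = a (q (b 0 + b 1) - q (b 0) - q (b 1)) := by
      rw [map_sub, map_sub, ← h2]; ring
    rw [h3]
    simp
    ring

/-! ### Vanishing of the obstruction on classes coming from a rational 2-torsion point -/

section Lift

variable {G A B C : Type*} [Group G] [TopologicalSpace G] [IsTopologicalGroup G]
  [CommGroup A] [Group B] [Group C]
  [MulDistribMulAction G A] [MulDistribMulAction G B] [MulDistribMulAction G C]

/-- The connecting map is trivial on a cocycle which lifts to a cocycle with values in `B`. -/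
lemma CentralExt.deltaZ_eq_one_of_lift (X : CentralExt G A B C) (a : NZ1 G C) (b : NZ1 G B)
    (hab : ∀ g, X.p (b.1 g) = a.1 g) : X.deltaZ a = 1 := by
  -- The set-theoretic lift and the cocycle lift differ by a central cochain `u`, and `delta` is the
  -- coboundary of `u`.
  have key : ∀ g, ∃ x, X.i x = X.lift a.1 g * (b.1 g)⁻¹ := by
    intro g
    rw [← X.exact]
    simp [X.p_lift, hab]
  choose u hu using key
  have hu' : ∀ g, X.lift a.1 g = X.i (u g) * b.1 g := fun g => by
    rw [hu, inv_mul_cancel_right]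
  have hulc : IsLocallyConstant u := by
    apply X.of_i_lc
    simp only [hu]
    exact (X.lift_lc a.2.1).mul b.2.1.inv
  rw [deltaZ, QuotientGroup.eq_one_iff]
  refine ⟨u, hulc, fun g h => ?_⟩
  have e : X.delta a (g, h) * u (g * h) = u g * g • u h := by
    apply X.inj
    apply mul_right_cancel (b := b.1 (g * h))
    have h1 := X.i_delta a g h
    rw [hu' g, hu' h, hu' (g * h)] at h1
    rw [map_mul, mul_assoc, h1, map_mul, X.i_smul, b.2.2]
    have c2 : b.1 g * g • X.i (u h) = g • X.i (u h) * b.1 g := by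
      rw [← X.i_smul, X.central]
    rw [smul_mul', mul_assoc, mul_assoc, ← mul_assoc (b.1 g), c2]
    simp only [mul_assoc]
  change g • u h / u (g * h) * u g = X.delta a (g, h)
  rw [div_mul_eq_mul_div, div_eq_iff_eq_mul, e, mul_comm]

end Lift

/-! ### A matrix of square one inducing the translation. -/

section TranslationMatrix

open Matrix WeierstrassCurve

variable {L : Type*} [Field L]

/-- For a 2-torsion point with `x`-coordinate `α` and `t² = f'(α)`, this matrix of square `1`
induces on `ℙ¹` the translation by that point. -/
def involution (α t : L) (ht : t ≠ 0) : GL (Fin 2) L :=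
  GeneralLinearGroup.mkOfDetNeZero !![α / t, (t ^ 2 - α ^ 2) / t; 1 / t, -α / t] (by
    rw [det_fin_two_of]
    have : α / t * (-α / t) - (t ^ 2 - α ^ 2) / t * (1 / t) = -1 := by field_simp; ring
    rw [this]
    exact neg_ne_zero.2 one_ne_zero)

/-- The matrix has trace `0` and determinant `-1`; the division by `t` is what achieves the latter.
-/
lemma involution_mul_self (α t : L) (ht : t ≠ 0) : involution α t ht * involution α t ht = 1 := by
  ext i j
  fin_cases i <;> fin_cases j <;>
    simp [involution, GeneralLinearGroup.mkOfDetNeZero, Matrix.mul_apply, Fin.sum_univ_two] <;>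
      field_simp <;> ring

/-- On `x`-coordinates the translation is `x ↦ α + t² / (x - α)`. The points at infinity and over
`α` are swapped and need separate treatment. -/
lemma isTranslation_involution {W : WeierstrassCurve L} {α y₀ t : L}
    (hns : W.toAffine.Nonsingular α y₀)
    (hP : (Affine.Point.some α y₀ hns : W.toAffine.Point) + .some α y₀ hns = 0) (ht : t ≠ 0)
    (htd : t ^ 2 = 3 * α ^ 2 + 2 * W.a₂ * α + W.a₄ - W.a₁ * y₀) :
    IsTranslation (Affine.Point.some α y₀ hns : W.toAffine.Point)
      (ProjGenLinGroup.mk (involution α t ht)) := by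
  have hy : 2 * y₀ + W.a₁ * α + W.a₃ = 0 := by
    have h := (Affine.Point.some.injEq ..).mp (eq_neg_of_add_eq_zero_left hP)
    have h2 := h.2
    simp only [Affine.negY] at h2
    linear_combination h2
  have heq := (Affine.equation_iff _ _).1 hns.1
  rw [isTranslation_mk]
  intro R
  change ∃ u : Lˣ, u • (Affine.Point.some α y₀ hns + R).xRep =
    !![α / t, (t ^ 2 - α ^ 2) / t; 1 / t, -α / t] *ᵥ R.xRep
  rcases R with _ | ⟨x, y, hR⟩
  · refine ⟨Units.mk0 t⁻¹ (inv_ne_zero ht), ?_⟩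
    change _ • (Affine.Point.some α y₀ hns + 0).xRep = _ *ᵥ Affine.Point.xRep 0
    rw [add_zero]
    ext i
    fin_cases i <;> simp [Units.smul_def, div_eq_mul_inv, mul_comm]
  have hReq := (Affine.equation_iff _ _).1 hR.1
  by_cases hx : x = α
  · subst hx
    -- The fibre of the degree two map over `α` is a single point, because `y₀` is a double root of
    -- the equation in `y`.
    have hyy : y = y₀ := by
      have h : (y - y₀) ^ 2 = 0 := by
        linear_combination hReq - heq - (y - y₀) * hy
      exact sub_eq_zero.1 (pow_eq_zero_iff two_ne_zero |>.1 h)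
    subst hyy
    rw [hP]
    refine ⟨Units.mk0 t ht, ?_⟩
    ext i
    fin_cases i
    · simp [Units.smul_def]; field_simp; ring
    · simp; field_simp; ring
  · have hx' : x - α ≠ 0 := sub_ne_zero.2 hx
    have hx'' : α - x ≠ 0 := sub_ne_zero.2 (Ne.symm hx)
    refine ⟨Units.mk0 ((x - α) / t) (div_ne_zero hx' ht), ?_⟩
    rw [Affine.Point.add_some (fun h => hx h.1.symm), Affine.Point.xRep_some,
      Affine.Point.xRep_some, Affine.slope_of_X_ne (Ne.symm hx)]
    ext i
    fin_cases i
    · simp [Units.smul_def, Affine.addX]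
      field_simp
      linear_combination (x - α) * (hReq - heq + (y₀ - y) * hy) - (x - α) ^ 2 * htd
    · simp [Units.smul_def]
      field_simp
      ring

end TranslationMatrix

/-! ### Cocycles given by a quadratic character times a rational point. -/

section Character

variable {K : Type*} [Field K] (W : WeierstrassCurve K) (L : Type*) [Field L] [Algebra K L]

/-- The cocycle `g ↦ χ(g) P` for a quadratic character `χ` and a rational 2-torsion point `P`. -/
def charCocycle (χ : Gal(L/K) → ZMod 2) (hχ : IsLocallyConstant χ)
    (hmul : ∀ g h, χ (g * h) = χ g + χ h) (P : E2 W L) (hP : ∀ g, galE2 W L g P = P) :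
    Z1 (galE2 W L) :=
  ⟨fun g => χ g • P, hχ.comp (· • P), fun g h => by
    change χ (g * h) • P = χ g • P + galE2 W L g (χ h • P)
    rw [hmul, add_smul, map_smul, hP]⟩

open Matrix WeierstrassCurve in
-- With `α` and `t` rational, `involution α t ht` is a Galois-fixed lift of the translation, and its
-- square is one. Sending `1 : ZMod 2` to it turns `χ` into a cocycle in `GL₂` lifting the given
-- class.
lemma obstruction_charCocycle [W.IsElliptic] [IsAlgClosed L] [Algebra.IsIntegral K L]
    (χ : Gal(L/K) → ZMod 2) (hχ : IsLocallyConstant χ)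
    (hmul : ∀ g h, χ (g * h) = χ g + χ h) (P : E2 W L) (hP : ∀ g, galE2 W L g P = P)
    {α y₀ t : L} (hns : (W.baseChange L).toAffine.Nonsingular α y₀)
    (hPα : P.1 = .some α y₀ hns) (hα : ∀ g : Gal(L/K), g α = α) (ht : t ≠ 0)
    (htd : t ^ 2 = 3 * α ^ 2 + 2 * (W.baseChange L).a₂ * α + (W.baseChange L).a₄ -
      (W.baseChange L).a₁ * y₀)
    (htg : ∀ g : Gal(L/K), g t = t) :
    obstruction W L (Submodule.Quotient.mk (charCocycle W L χ hχ hmul P hP)) = 1 := by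
  have htheta : theta W L (.ofAdd P) = ProjGenLinGroup.mk (involution α t ht) := by
    refine (theta_isTranslation P).unique ?_
    rw [hPα]
    refine isTranslation_involution hns ?_ ht htd
    rw [← hPα]
    exact E2.add_self P
  have hfix (g : Gal(L/K)) : g • involution α t ht = involution α t ht := by
    ext i j
    rw [galGL_apply]
    fin_cases i <;> fin_cases j <;>
      simp [involution, GeneralLinearGroup.mkOfDetNeZero, hα, htg]
  refine (pglExt K L).deltaZ_eq_one_of_lift _
    ⟨fun g => if χ g = 0 then 1 else involution α t ht,
      hχ.comp fun a => if a = 0 then 1 else involution α t ht, fun g h => ?_⟩ fun g => ?_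
  · change (if χ (g * h) = 0 then 1 else involution α t ht) =
      (if χ g = 0 then 1 else involution α t ht) *
        g • (if χ h = 0 then 1 else involution α t ht)
    rw [hmul]
    rcases ZMod.eq_zero_or_one (χ g) with h1 | h1 <;>
      rcases ZMod.eq_zero_or_one (χ h) with h2 | h2 <;>
        simp [h1, h2, hfix, involution_mul_self, CharTwo.add_self_eq_zero]
  · change ProjGenLinGroup.mk (if χ g = 0 then 1 else involution α t ht) =
      theta W L (.ofAdd (χ g • P))
    rcases ZMod.eq_zero_or_one (χ g) with h1 | h1 <;> simp [h1, htheta]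

lemma formF2_zero [W.IsElliptic] [IsAlgClosed L] [Algebra.IsIntegral K L] :
    formF2 W L 0 = 0 := by
  refine if_pos ?_
  refine (pglExt K L).deltaZ_eq_one_of_lift _ ⟨fun _ => 1, .const 1, fun g h => by simp⟩ fun g => ?_
  rw [map_one]
  exact (map_one (theta W L)).symm

end Character

/-! ### The 2-torsion points in terms of the roots of the 2-division polynomial -/

section TwoTorsion

open WeierstrassCurve

variable {L : Type*} [Field L]

/-- `α, β, γ` are the roots of the 2-division polynomial `4X³ + b₂X² + 2b₄X + b₆`. -/
structure IsRoots (V : WeierstrassCurve L) (α β γ : L) : Prop where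
  b₂ : V.b₂ = -4 * (α + β + γ)
  b₄ : V.b₄ = 2 * (α * β + α * γ + β * γ)
  b₆ : V.b₆ = -4 * (α * β * γ)

/-- `x` is a root of the 2-division polynomial. -/
def IsDivRoot (V : WeierstrassCurve L) (x : L) : Prop :=
  4 * x ^ 3 + V.b₂ * x ^ 2 + 2 * V.b₄ * x + V.b₆ = 0

namespace IsRoots

variable {V : WeierstrassCurve L} {α β γ : L}

lemma swap₁₂ (h : IsRoots V α β γ) : IsRoots V β α γ :=
  ⟨by rw [h.b₂]; ring, by rw [h.b₄]; ring, by rw [h.b₆]; ring⟩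

lemma swap₂₃ (h : IsRoots V α β γ) : IsRoots V α γ β :=
  ⟨by rw [h.b₂]; ring, by rw [h.b₄]; ring, by rw [h.b₆]; ring⟩

lemma eval (h : IsRoots V α β γ) (x : L) :
    4 * x ^ 3 + V.b₂ * x ^ 2 + 2 * V.b₄ * x + V.b₆ = 4 * ((x - α) * (x - β) * (x - γ)) := by
  rw [h.b₂, h.b₄, h.b₆]; ring

lemma isDivRoot (h : IsRoots V α β γ) : IsDivRoot V α := by
  rw [IsDivRoot, h.eval]; ring

lemma discr [CharZero L] (h : IsRoots V α β γ) :
    V.Δ = 16 * ((α - β) * (α - γ) * (β - γ)) ^ 2 := by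
  have h8 := V.b_relation
  -- The factor `4` makes `b₈` enter only through `4 * b₈ = b₂ * b₆ - b₄ ^ 2`.
  have hΔ : 4 * V.Δ = -V.b₂ ^ 2 * (4 * V.b₈) - 32 * V.b₄ ^ 3 - 108 * V.b₆ ^ 2 +
      36 * V.b₂ * V.b₄ * V.b₆ := by rw [Δ]; ring
  rw [h8, h.b₂, h.b₄, h.b₆] at hΔ
  have h4 : (4 : L) ≠ 0 := by norm_num
  apply mul_left_cancel₀ h4
  rw [hΔ]; ring

lemma ne [CharZero L] [V.IsElliptic] (h : IsRoots V α β γ) : α ≠ β := by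
  rintro rfl
  apply V.isUnit_Δ.ne_zero
  rw [h.discr]; ring

lemma exists_of_isAlgClosed [IsAlgClosed L] [CharZero L] (V : WeierstrassCurve L) :
    ∃ α β γ, IsRoots V α β γ := by
  have h4 : (4 : L) ≠ 0 := by norm_num
  have h2 : (2 : L) ≠ 0 := by norm_num
  obtain ⟨α, hα⟩ := IsAlgClosed.exists_root
    (Polynomial.C 4 * Polynomial.X ^ 3 + Polynomial.C V.b₂ * Polynomial.X ^ 2 +
      Polynomial.C (2 * V.b₄) * Polynomial.X + Polynomial.C V.b₆)
    (by rw [Polynomial.degree_cubic h4]; decide)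
  -- This quadratic is the quotient of the cubic by `X - α`; the third root is then read off from
  -- the sum of the roots.
  obtain ⟨β, hβ⟩ := IsAlgClosed.exists_root
    (Polynomial.C 4 * Polynomial.X ^ 2 + Polynomial.C (4 * α + V.b₂) * Polynomial.X +
      Polynomial.C (4 * α ^ 2 + V.b₂ * α + 2 * V.b₄))
    (by rw [Polynomial.degree_quadratic h4]; decide)
  simp at hα hβ
  refine ⟨α, β, -V.b₂ / 4 - α - β, ?_, ?_, ?_⟩
  · field_simp; ring
  · apply mul_left_cancel₀ h2
    linear_combination hβ
  · linear_combination hα - α * hβ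

end IsRoots

lemma IsDivRoot.eq_or [CharZero L] {V : WeierstrassCurve L} {α β γ x : L} (hx : IsDivRoot V x)
    (h : IsRoots V α β γ) : x = α ∨ x = β ∨ x = γ := by
  rw [IsDivRoot, h.eval] at hx
  have h4 : (4 : L) ≠ 0 := by norm_num
  simpa [h4, sub_eq_zero, or_assoc] using hx

variable {K : Type*} [Field K] (W : WeierstrassCurve K) [Algebra K L]

lemma IsDivRoot.gal {W : WeierstrassCurve K} {x : L} (hx : IsDivRoot (W.baseChange L) x)
    (g : Gal(L/K)) :
    IsDivRoot (W.baseChange L) (g x) := by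
  have := congrArg g hx
  simpa [IsDivRoot, baseChange, map_ofNat] using this

variable [W.IsElliptic] [CharZero L]

/-- Multiplying the Weierstrass equation by `4` and completing the square in `y` leaves the
2-division polynomial. This `y` makes the square vanish, so the point equals its negative. -/
lemma IsDivRoot.equation {V : WeierstrassCurve L} {x : L} (hx : IsDivRoot V x) :
    V.toAffine.Equation x (-(V.a₁ * x + V.a₃) / 2) := by
  have h4 : (4 : L) ≠ 0 := by norm_num
  rw [Affine.equation_iff]
  rw [IsDivRoot, b₂, b₄, b₆] at hx
  apply mul_left_cancel₀ h4
  field_simp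
  linear_combination -hx

/-- The 2-torsion point with a given `x`-coordinate. -/
def torsionPoint (x : L) (hx : IsDivRoot (W.baseChange L) x) : E2 W L :=
  ⟨.some x _ (Affine.equation_iff_nonsingular.1 hx.equation), by
    rw [AddSubgroup.torsionBy.nsmul_iff, two_nsmul]
    apply Affine.Point.add_self_of_Y_eq
    simp only [Affine.negY]
    ring⟩

variable {W}

lemma torsionPoint_ne_zero (x : L) (hx : IsDivRoot (W.baseChange L) x) :
    torsionPoint W x hx ≠ 0 := by
  intro h
  exact Affine.Point.some_ne_zero _ (congrArg Subtype.val h)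

lemma torsionPoint_inj {x y : L} {hx : IsDivRoot (W.baseChange L) x}
    {hy : IsDivRoot (W.baseChange L) y} (h : torsionPoint W x hx = torsionPoint W y hy) :
    x = y :=
  ((Affine.Point.some.injEq ..).mp (congrArg Subtype.val h)).1

lemma eq_zero_or_torsionPoint (P : E2 W L) : P = 0 ∨ ∃ x hx, P = torsionPoint W x hx := by
  have hP := E2.add_self P
  rcases P with ⟨_ | ⟨x, y, h⟩, hP'⟩
  · exact .inl rfl
  right
  have h2 := ((Affine.Point.some.injEq ..).mp (eq_neg_of_add_eq_zero_left hP)).2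
  simp only [Affine.negY] at h2
  have hy : y = -((W.baseChange L).a₁ * x + (W.baseChange L).a₃) / 2 := by
    field_simp
    linear_combination h2
  have hx : IsDivRoot (W.baseChange L) x := by
    have := (Affine.equation_iff _ _).1 h.1
    rw [IsDivRoot, b₂, b₄, b₆]
    linear_combination -4 * this + (2 * y + (W.baseChange L).a₁ * x + (W.baseChange L).a₃) * h2
  refine ⟨x, hx, ?_⟩
  subst hy
  rfl

lemma galE2_torsionPoint (g : Gal(L/K)) (x : L) (hx : IsDivRoot (W.baseChange L) x) :
    galE2 W L g (torsionPoint W x hx) = torsionPoint W (g x) (hx.gal g) := by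
  apply Subtype.ext
  exact (Affine.Point.some.injEq ..).mpr ⟨rfl, by simp [baseChange, map_ofNat]⟩

variable {α β γ : L}

/-- By elimination, without the addition formula: the sum is `0` or one of the three points, and all
but the third would force two distinct points to agree or a nonzero point to vanish. -/
lemma torsionPoint_add (h : IsRoots (W.baseChange L) α β γ) :
    torsionPoint W α h.isDivRoot + torsionPoint W β h.swap₁₂.isDivRoot =
      torsionPoint W γ h.swap₂₃.swap₁₂.isDivRoot := by
  rcases eq_zero_or_torsionPoint
    (torsionPoint W α h.isDivRoot + torsionPoint W β h.swap₁₂.isDivRoot) with h0 | ⟨x, hx, h1⟩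
  · exfalso
    have h2 : torsionPoint W α h.isDivRoot + torsionPoint W α h.isDivRoot = 0 :=
      Subtype.ext (E2.add_self _)
    exact h.ne (torsionPoint_inj (add_left_cancel (h2.trans h0.symm)))
  · rcases hx.eq_or h with rfl | rfl | rfl
    · exact absurd (add_eq_left.1 h1) (torsionPoint_ne_zero _ _)
    · exact absurd (add_eq_right.1 h1) (torsionPoint_ne_zero _ _)
    · exact h1

/-- The basis of `E[2]` given by two distinct nonzero points. -/
def torsionBasis (h : IsRoots (W.baseChange L) α β γ) :
    Module.Basis (Fin 2) (ZMod 2) (E2 W L) :=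
  .mk (v := ![torsionPoint W α h.isDivRoot, torsionPoint W β h.swap₁₂.isDivRoot]) (by
    rw [LinearIndependent.pair_iff]
    intro s t hst
    rcases ZMod.eq_zero_or_one s with rfl | rfl <;> rcases ZMod.eq_zero_or_one t with rfl | rfl
    · exact ⟨rfl, rfl⟩
    · simp [torsionPoint_ne_zero] at hst
    · simp [torsionPoint_ne_zero] at hst
    · simp [torsionPoint_add h, torsionPoint_ne_zero] at hst) (by
    rintro P -
    rw [Matrix.range_cons, Matrix.range_cons, Matrix.range_empty, Set.union_empty,
      Set.singleton_union, Submodule.mem_span_pair]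
    rcases eq_zero_or_torsionPoint P with rfl | ⟨x, hx, rfl⟩
    · exact ⟨0, 0, by simp⟩
    · rcases hx.eq_or h with rfl | rfl | rfl
      · exact ⟨1, 0, by simp⟩
      · exact ⟨0, 1, by simp⟩
      · exact ⟨1, 1, by simp [torsionPoint_add h]⟩)

lemma torsionBasis_zero (h : IsRoots (W.baseChange L) α β γ) :
    torsionBasis h 0 = torsionPoint W α h.isDivRoot := by
  simp [torsionBasis]

lemma torsionBasis_one (h : IsRoots (W.baseChange L) α β γ) :
    torsionBasis h 1 = torsionPoint W β h.swap₁₂.isDivRoot := by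
  simp [torsionBasis]

end TwoTorsion

/-! ### Unipotent actions on a plane -/

section Unipotent

variable {k G M : Type*} [Field k] [Group G] [AddCommGroup M] [Module k M]

/-- In the basis `b` the group acts through the unipotent matrices `g ↦ !![1, ψ g; 0, 1]`. -/
structure IsUnipotent (ρ : Representation k G M) (b : Module.Basis (Fin 2) k M) (ψ : G → k) :
    Prop where
  zero : ∀ g, ρ g (b 0) = b 0
  one : ∀ g, ρ g (b 1) = b 1 + ψ g • b 0

namespace IsUnipotent

variable {ρ : Representation k G M} {b : Module.Basis (Fin 2) k M} {ψ : G → k}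

/-- Everything about the unipotent action is read off from this formula: `ρ g - 1` maps into the
line of `b 0` and sees only the second coordinate. -/
lemma apply_sub (h : IsUnipotent ρ b ψ) (g : G) (m : M) :
    ρ g m - m = (b.repr m 1 * ψ g) • b 0 := by
  have hm := b.sum_repr m
  rw [Fin.sum_univ_two] at hm
  conv_lhs => rw [← hm]
  rw [map_add, map_smul, map_smul, h.zero, h.one, smul_add, smul_smul]
  abel

/-- The stable line. -/
def line (h : IsUnipotent ρ b ψ) : Subrepresentation ρ where
  toSubmodule := Submodule.span k {b 0}
  apply_mem_toSubmodule g v hv := by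
    have := h.apply_sub g v
    rw [sub_eq_iff_eq_add] at this
    rw [this]
    exact Submodule.add_mem _ (Submodule.smul_mem _ _ (Submodule.mem_span_singleton_self _)) hv

lemma finrank_line (h : IsUnipotent ρ b ψ) : Module.finrank k h.line.toSubmodule = 1 :=
  finrank_span_singleton (b.ne_zero 0)

/-- For a generator `v` of a stable line, `ρ g₀ v - v` is the second coordinate of `v` times `b 0`.
If that coordinate is nonzero, `b 0` lies in the line; otherwise `v` is itself a multiple of `b 0`.
-/
lemma eq_line (h : IsUnipotent ρ b ψ) {g₀ : G} (hg₀ : ψ g₀ = 1)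
    (U : Subrepresentation ρ) (hU : Module.finrank k U.toSubmodule = 1) :
    U = h.line := by
  have hb0 : b 0 ∈ U.toSubmodule := by
    obtain ⟨v, hv0, -⟩ := finrank_eq_one_iff'.1 hU
    have hv0' : v.1 ≠ 0 := fun hv => hv0 (Subtype.ext hv)
    have h1 := Submodule.sub_mem _ (U.apply_mem_toSubmodule g₀ v.2) v.2
    rw [h.apply_sub, hg₀, mul_one] at h1
    by_cases h2 : b.repr v.1 1 = 0
    · have hm := b.sum_repr v.1
      rw [Fin.sum_univ_two, h2, zero_smul, add_zero] at hm
      have h3 : b.repr v.1 0 ≠ 0 := by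
        intro h3
        rw [h3, zero_smul] at hm
        exact hv0' hm.symm
      rw [← U.toSubmodule.smul_mem_iff h3, hm]
      exact v.2
    · exact (U.toSubmodule.smul_mem_iff h2).1 h1
  have : FiniteDimensional k U.toSubmodule := Module.finite_of_finrank_eq_succ hU
  refine (Subrepresentation.toSubmodule_injective ?_).symm
  refine Submodule.eq_of_le_of_finrank_eq ?_ (h.finrank_line.trans hU.symm)
  exact (Submodule.span_singleton_le_iff_mem _ _).2 hb0

variable [TopologicalSpace G]

/-- The element `g₁` acts trivially, so every coboundary vanishes there, but `z` does not. -/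
lemma mk_ne_zero (h : IsUnipotent ρ b ψ) {χ : G → k} {z : Z1 ρ} (hz : ∀ g, z.1 g = χ g • b 0)
    {g₁ : G} (hχ₁ : χ g₁ = 1) (hψ₁ : ψ g₁ = 0) :
    (Submodule.Quotient.mk z : H1 ρ) ≠ 0 := by
  rw [Ne, H1.mk_eq_zero_iff]
  rintro ⟨m, hm⟩
  have := hm g₁
  rw [h.apply_sub, hψ₁, mul_zero, zero_smul, hz, hχ₁, one_smul] at this
  exact b.ne_zero 0 this.symm

/-- If all continuous characters `G → k` are combinations of `χ` and `ψ`, then the image in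
`H¹(G, M)` of the cohomology of the stable line is spanned by the class of `χ • b 0`. -/
lemma imageOfSub_line (h : IsUnipotent ρ b ψ) {χ : G → k} {z : Z1 ρ}
    (hz : ∀ g, z.1 g = χ g • b 0)
    (hspan : ∀ f : G → k, IsLocallyConstant f → (∀ g h, f (g * h) = f g + f h) →
      ∃ x y : k, ∀ g, f g = x * χ g + y * ψ g) :
    imageOfSub ρ h.line = Submodule.span k {Submodule.Quotient.mk z} := by
  have hfinj : Function.Injective fun a : k => a • b 0 := smul_left_injective k (b.ne_zero 0)
  have lc_of {f : G → k} {F : G → M} (hF : IsLocallyConstant F) (hf : ∀ g, f g • b 0 = F g) :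
      IsLocallyConstant f := by
    have : IsLocallyConstant ((fun a : k => a • b 0) ∘ f) := by
      have h2 : (fun a : k => a • b 0) ∘ f = F := funext hf
      rwa [h2]
    exact this.desc _ _ hfinj
  have hom_of {f : G → k} {c : Z1 ρ} (hf : ∀ g, f g • b 0 = c.1 g) (g₁ g₂ : G) :
      f (g₁ * g₂) = f g₁ + f g₂ := by
    apply hfinj
    change f (g₁ * g₂) • b 0 = (f g₁ + f g₂) • b 0
    rw [hf, c.2.2, ← hf, ← hf, map_smul, h.zero, add_smul]
  apply le_antisymm
  · rintro _ ⟨c, rfl⟩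
    obtain ⟨c, rfl⟩ := Submodule.Quotient.mk_surjective _ c
    choose f hf using fun g => Submodule.mem_span_singleton.1 (c.1 g).2
    obtain ⟨x, y, hxy⟩ := hspan f (lc_of (c.2.1.comp Subtype.val) hf)
      (hom_of (c := Z1.map h.line.toRepresentation ρ h.line.toSubmodule.subtype
        (fun _ _ => rfl) c) hf)
    refine Submodule.mem_span_singleton.2 ⟨x, ?_⟩
    rw [← Submodule.Quotient.mk_smul, ← sub_eq_zero]
    change Submodule.Quotient.mk (_ - Z1.map _ _ _ _ c) = (0 : H1 ρ)
    rw [H1.mk_eq_zero_iff]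
    -- The coboundary of `b 1` is `ψ • b 0`, so the `ψ`-component of the character dies in `H¹(G,
    -- M)`.
    refine ⟨-(y • b 1), fun g => ?_⟩
    change _ = x • z.1 g - (c.1 g).1
    rw [h.apply_sub, ← hf, hxy g, hz, map_neg, map_smul]
    simp only [Module.Basis.repr_self, Finsupp.neg_apply, Finsupp.smul_apply, smul_eq_mul,
      Finsupp.single_apply, if_true, mul_one]
    rw [smul_smul, ← sub_smul]
    congr 1
    ring
  · rw [Submodule.span_singleton_le_iff_mem]
    have h0 (g : G) : z.1 g ∈ h.line.toSubmodule := by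
      rw [hz]
      exact Submodule.smul_mem _ _ (Submodule.mem_span_singleton_self _)
    refine ⟨Submodule.Quotient.mk ⟨fun g => ⟨z.1 g, h0 g⟩, ?_, fun g₁ g₂ => ?_⟩, rfl⟩
    · refine IsLocallyConstant.desc (fun g => (⟨z.1 g, h0 g⟩ : h.line.toSubmodule)) Subtype.val
        ?_ Subtype.val_injective
      exact z.2.1
    · exact Subtype.ext (z.2.2 g₁ g₂)

end IsUnipotent

end Unipotent

/-! ### Unipotent action on `E[2]`: stable line, quadratic form, isotropy. -/

section UnipotentTorsion

variable {K : Type*} [Field K] {W : WeierstrassCurve K} {L : Type*} [Field L] [Algebra K L]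
  (k : Type*) [Field k] [Algebra (ZMod 2) k]

lemma galV_tmul (g : Gal(L/K)) (a : k) (P : E2 W L) :
    galV W L k g (a ⊗ₜ P) = a ⊗ₜ galE2 W L g P := LinearMap.baseChange_tmul _ _ _

lemma IsUnipotent.galV {b : Module.Basis (Fin 2) (ZMod 2) (E2 W L)} {ψ : Gal(L/K) → ZMod 2}
    (h : IsUnipotent (galE2 W L) b ψ) :
    IsUnipotent (galV W L k) (b.baseChange k) fun g => algebraMap (ZMod 2) k (ψ g) where
  zero g := by rw [Module.Basis.baseChange_apply, galV_tmul, h.zero]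
  one g := by
    rw [Module.Basis.baseChange_apply, Module.Basis.baseChange_apply, galV_tmul, h.one,
      TensorProduct.tmul_add, TensorProduct.tmul_smul, algebraMap_smul]

variable {k} in
/-- If the continuous characters with values in `𝔽₂` are spanned by two characters which can be
separated, then so are those with values in `k`. -/
lemma exists_eq_of_forall_zmod {G : Type*} [Group G] [TopologicalSpace G] {χ ψ : G → ZMod 2}
    {g₀ g₁ : G} (hψ₀ : ψ g₀ = 1) (hχ₀ : χ g₀ = 0) (hχ₁ : χ g₁ = 1) (hψ₁ : ψ g₁ = 0)
    (hspan : ∀ f : G → ZMod 2, IsLocallyConstant f → (∀ g h, f (g * h) = f g + f h) →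
      ∃ x y : ZMod 2, ∀ g, f g = x * χ g + y * ψ g)
    (f : G → k) (hf : IsLocallyConstant f) (hmul : ∀ g h, f (g * h) = f g + f h) :
    ∃ x y : k, ∀ g, f g = x * algebraMap (ZMod 2) k (χ g) + y * algebraMap (ZMod 2) k (ψ g) := by
  -- The separating elements read off the coefficients. The identity is then tested after each
  -- functional `k → 𝔽₂`, where `hspan` applies.
  refine ⟨f g₁, f g₀, fun g => ?_⟩
  rw [← sub_eq_zero, ← Module.forall_dual_apply_eq_zero_iff (ZMod 2)]
  intro φ
  obtain ⟨x, y, hxy⟩ := hspan (fun g => φ (f g)) (hf.comp φ) fun g₁ g₂ => by rw [hmul, map_add]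
  have e0 := hxy g₀
  have e1 := hxy g₁
  rw [hχ₀, hψ₀] at e0
  rw [hχ₁, hψ₁] at e1
  have hsm (a : k) (r : ZMod 2) : φ (a * algebraMap (ZMod 2) k r) = r * φ a := by
    rw [mul_comm, ← Algebra.smul_def, map_smul, smul_eq_mul]
  rw [map_sub, map_add, hsm, hsm, hxy, e0, e1]
  ring

variable [W.IsElliptic] [IsAlgClosed L] [Algebra.IsIntegral K L]

/-- The rank descends to `𝔽₂`, and on a plane over `𝔽₂` the only property of the obstruction needed
is `formF2_zero`. -/
lemma existsUnique_isScalarExtension [Finite k]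
    (hk : Module.finrank k (H1 (galV W L k)) = 2) : ∃! Q, IsScalarExtension W L k Q := by
  rw [finrank_H1_galV] at hk
  have : FiniteDimensional (ZMod 2) (H1 (galE2 W L)) := Module.finite_of_finrank_eq_succ hk
  let b := Module.finBasisOfFinrankEq (ZMod 2) (H1 (galE2 W L)) hk
  exact existsUnique_quadraticForm b (scalarBasis W L b) (scalarMap W L k)
    (fun i => (scalarBasis_apply W L b i).symm) (formF2 W L) (formF2_zero W L)

/-- The statement about the stable line, its cohomology and the quadratic form, for a unipotent
Galois action on `E[2]`. -/
theorem isotropic_of_isUnipotent [Finite k] (hk : Module.finrank k (H1 (galV W L k)) = 2)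
    {b : Module.Basis (Fin 2) (ZMod 2) (E2 W L)} {ψ χ : Gal(L/K) → ZMod 2}
    (h : IsUnipotent (galE2 W L) b ψ) (hχ : IsLocallyConstant χ)
    (hmul : ∀ g h, χ (g * h) = χ g + χ h)
    {g₀ g₁ : Gal(L/K)} (hψ₀ : ψ g₀ = 1) (hχ₀ : χ g₀ = 0) (hχ₁ : χ g₁ = 1) (hψ₁ : ψ g₁ = 0)
    (hspan : ∀ f : Gal(L/K) → ZMod 2, IsLocallyConstant f → (∀ g h, f (g * h) = f g + f h) →
      ∃ x y : ZMod 2, ∀ g, f g = x * χ g + y * ψ g)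
    (hobs : obstruction W L (Submodule.Quotient.mk (charCocycle W L χ hχ hmul (b 0) h.zero)) = 1) :
    (∃! U : Subrepresentation (galV W L k), Module.finrank k U.toSubmodule = 1) ∧
      (∃! Q, IsScalarExtension W L k Q) ∧
      ∀ (U : Subrepresentation (galV W L k)) (Q : QuadraticForm k (H1 (galV W L k))),
        Module.finrank k U.toSubmodule = 1 → IsScalarExtension W L k Q →
        Module.finrank k (imageOfSub _ U) = 1 ∧ ∀ x ∈ imageOfSub _ U, Q x = 0 := by
  have hV := h.galV k
  have hψ₀' : algebraMap (ZMod 2) k (ψ g₀) = 1 := by rw [hψ₀, map_one]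
  refine ⟨⟨hV.line, hV.finrank_line, fun U hU => hV.eq_line hψ₀' U hU⟩,
    existsUnique_isScalarExtension k hk, fun U Q hU hQ => ?_⟩
  obtain rfl := hV.eq_line hψ₀' U hU
  have himg := hV.imageOfSub_line (χ := fun g => algebraMap (ZMod 2) k (χ g))
    (z := Z1.map (galE2 W L) (GalCoh.galV W L k) (σ := algebraMap (ZMod 2) k)
        { toFun := fun P => (1 : k) ⊗ₜ[ZMod 2] P
          map_add' := fun P P' => TensorProduct.tmul_add _ _ _
          map_smul' := fun a P => by
            rw [TensorProduct.tmul_smul, algebraMap_smul] }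
        (fun g P => (LinearMap.baseChange_tmul _ _ _).symm) (charCocycle W L χ hχ hmul (b 0) h.zero))
    (fun g => by
      change (1 : k) ⊗ₜ (χ g • b 0) = _
      rw [TensorProduct.tmul_smul, Module.Basis.baseChange_apply, algebraMap_smul])
    (exists_eq_of_forall_zmod hψ₀ hχ₀ hχ₁ hψ₁ hspan)
  rw [← scalarMap_mk] at himg
  rw [himg]
  constructor
  · refine finrank_span_singleton fun h0 => ?_
    exact h.mk_ne_zero (χ := χ) (fun _ => rfl) hχ₁ hψ₁
      (scalarMap_injective W L (h0.trans (map_zero (scalarMap W L k)).symm))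
  · intro x hx
    -- Homogeneity reduces isotropy to the generator, which comes from `H¹(E[2])` and has trivial
    -- obstruction.
    obtain ⟨a, rfl⟩ := Submodule.mem_span_singleton.1 hx
    rw [QuadraticMap.map_smul, hQ, formF2, if_pos hobs, map_zero, smul_zero]

end UnipotentTorsion

/-! ### Quadratic characters -/

section QuadChar

variable {K L : Type*} [Field K] [Field L] [Algebra K L]

/-- The quadratic character of `Gal(L/K)` attached to a square root `θ` of an element of `K`. -/
def quadChar (θ : L) (g : Gal(L/K)) : ZMod 2 := if g θ = θ then 0 else 1

/-- `θ` is a nonzero square root of an element fixed by the Galois group. -/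
structure IsSqrt (K : Type*) {L : Type*} [Field K] [Field L] [Algebra K L] (θ : L) : Prop where
  ne_zero : θ ≠ 0
  sq : ∀ g : Gal(L/K), g (θ ^ 2) = θ ^ 2

lemma quadChar_eq_zero {θ : L} {g : Gal(L/K)} : quadChar θ g = 0 ↔ g θ = θ := by
  simp [quadChar]

lemma quadChar_eq_one {θ : L} {g : Gal(L/K)} : quadChar θ g = 1 ↔ g θ ≠ θ := by
  simp [quadChar]

lemma quadChar_lc [Algebra.IsIntegral K L] (θ : L) :
    IsLocallyConstant (quadChar θ : Gal(L/K) → ZMod 2) := by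
  rw [IsLocallyConstant.iff_eventually_eq]
  intro g
  have h1 : ∀ᶠ s : Gal(L/K) in 𝓝 1, s ∈ MulAction.stabilizer Gal(L/K) θ :=
    (stabilizer_isOpen_of_isIntegral (K := K) θ).mem_nhds (one_mem _)
  have h2 : Filter.Tendsto (fun h : Gal(L/K) => g⁻¹ * h) (𝓝 g) (𝓝 1) := by
    have := (continuous_const_mul g⁻¹).tendsto g
    rwa [inv_mul_cancel] at this
  filter_upwards [h2.eventually h1] with h hh
  have h3 : (g⁻¹ * h) • θ = θ := hh
  rw [mul_smul, inv_smul_eq_iff] at h3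
  have h4 : h θ = g θ := h3
  rw [quadChar, quadChar, h4]

namespace IsSqrt

variable {θ θ' : L}

lemma mul (h : IsSqrt K θ) (h' : IsSqrt K θ') : IsSqrt K (θ * θ') :=
  ⟨mul_ne_zero h.ne_zero h'.ne_zero, fun g => by rw [mul_pow, map_mul, h.sq, h'.sq]⟩

lemma eq_or (h : IsSqrt K θ) (g : Gal(L/K)) : g θ = θ ∨ g θ = -θ := by
  have := h.sq g
  rw [map_pow] at this
  exact sq_eq_sq_iff_eq_or_eq_neg.1 this

variable [CharZero L]

lemma neg_ne (h : IsSqrt K θ) : -θ ≠ θ := by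
  rw [Ne, neg_eq_self]
  exact h.ne_zero

lemma quadChar_mul_apply (h : IsSqrt K θ) (g g' : Gal(L/K)) :
    quadChar θ (g * g') = quadChar θ g + quadChar θ g' := by
  have hmul : (g * g') θ = g (g' θ) := rfl
  rcases h.eq_or g with h1 | h1 <;> rcases h.eq_or g' with h2 | h2 <;>
    simp [quadChar, hmul, h1, h2, h.neg_ne, CharTwo.add_self_eq_zero]

lemma quadChar_mul (h : IsSqrt K θ) (h' : IsSqrt K θ') (g : Gal(L/K)) :
    quadChar (θ * θ') g = quadChar θ g + quadChar θ' g := by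
  have h3 := (h.mul h').neg_ne
  rcases h.eq_or g with h1 | h1 <;> rcases h'.eq_or g with h2 | h2 <;>
    simp_all [quadChar, h.neg_ne, h'.neg_ne, CharTwo.add_self_eq_zero]

end IsSqrt

/-- Every continuous character with values in `𝔽₂` is the quadratic character of a square root. -/
lemma exists_eq_quadChar [CharZero L] [IsGalois K L] (f : Gal(L/K) → ZMod 2)
    (hf : IsLocallyConstant f) (hmul : ∀ g h, f (g * h) = f g + f h) :
    ∃ θ : L, IsSqrt K θ ∧ f = quadChar θ := by
  have h1 : f 1 = 0 := by simpa using hmul 1 1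
  by_cases hf0 : ∀ g, f g = 0
  · refine ⟨1, ⟨one_ne_zero, by simp⟩, funext fun g => ?_⟩
    rw [hf0, eq_comm, quadChar_eq_zero, map_one]
  push Not at hf0
  obtain ⟨g₀, hg₀⟩ := hf0
  have hinv (g) : f g⁻¹ = f g := by
    have := hmul g g⁻¹
    rw [mul_inv_cancel, h1] at this
    rw [← CharTwo.neg_eq (f g)]
    exact (neg_eq_of_add_eq_zero_right this.symm).symm
  -- The kernel of `f` is closed, so by Galois theory some `y` is fixed by it and moved by `g₀`.
  -- Then `y - g₀ y` is multiplied by `-1` exactly where `f` is `1`.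
  let H : ClosedSubgroup Gal(L/K) :=
    { carrier := f ⁻¹' {0}
      one_mem' := h1
      mul_mem' := fun {a b} ha hb => by
        change f (a * b) = 0
        rw [hmul, show f a = 0 from ha, show f b = 0 from hb, add_zero]
      inv_mem' := fun {a} ha => by
        change f a⁻¹ = 0
        rw [hinv, show f a = 0 from ha]
      isClosed' := hf.isClosed_fiber 0 }
  have hH := InfiniteGalois.fixingSubgroup_fixedField H
  have hg₀H : g₀ ∉ (IntermediateField.fixedField H.1).fixingSubgroup := by
    rw [hH]
    exact hg₀
  rw [IntermediateField.mem_fixingSubgroup_iff] at hg₀H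
  push Not at hg₀H
  obtain ⟨y, hy, hgy⟩ := hg₀H
  rw [IntermediateField.mem_fixedField_iff] at hy
  have hfix (g) (hg : f g = 0) : g y = y := hy g hg
  have hg₀1 : f g₀ = 1 := (ZMod.eq_zero_or_one _).resolve_left hg₀
  have hmove (g) (hg : f g = 1) : g y = g₀ y := by
    have := hfix (g₀⁻¹ * g) (by rw [hmul, hinv, hg, hg₀1]; decide)
    exact (AlgEquiv.symm_apply_eq g₀).1 this
  have hsq : g₀ (g₀ y) = y := hfix (g₀ * g₀) (by rw [hmul, CharTwo.add_self_eq_zero])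
  have hθ : y - g₀ y ≠ 0 := sub_ne_zero.2 (Ne.symm hgy)
  have hact0 (g) (hg : f g = 0) : g (y - g₀ y) = y - g₀ y := by
    have : g (g₀ y) = g₀ y := hmove (g * g₀) (by rw [hmul, hg, hg₀1, zero_add])
    rw [map_sub, hfix g hg, this]
  have hact1 (g) (hg : f g = 1) : g (y - g₀ y) = -(y - g₀ y) := by
    have : g (g₀ y) = y := hfix (g * g₀) (by rw [hmul, hg, hg₀1]; decide)
    rw [map_sub, hmove g hg, this, neg_sub]
  have hs : IsSqrt K (y - g₀ y) := by
    refine ⟨hθ, fun g => ?_⟩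
    rcases ZMod.eq_zero_or_one (f g) with h | h
    · rw [map_pow, hact0 g h]
    · rw [map_pow, hact1 g h, neg_sq]
  refine ⟨y - g₀ y, hs, funext fun g => ?_⟩
  rcases ZMod.eq_zero_or_one (f g) with h | h
  · rw [h, eq_comm, quadChar_eq_zero, hact0 g h]
  · rw [h, eq_comm, quadChar_eq_one, hact1 g h]
    exact hs.neg_ne

/-- Two independent characters with values in `𝔽₂` can be separated. -/
lemma exists_separating {G : Type*} [Group G] {χ ψ : G → ZMod 2}
    (hχ : ∀ g h, χ (g * h) = χ g + χ h) (hψ : ∀ g h, ψ (g * h) = ψ g + ψ h)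
    (h1 : ∃ g, χ g = 1) (h2 : ∃ g, ψ g = 1) (h3 : ∃ g, χ g + ψ g = 1) :
    (∃ g, χ g = 1 ∧ ψ g = 0) ∧ ∃ g, χ g = 0 ∧ ψ g = 1 := by
  obtain ⟨a, ha⟩ := h1
  obtain ⟨b, hb⟩ := h2
  obtain ⟨c, hc⟩ := h3
  rcases ZMod.eq_zero_or_one (χ c) with hc1 | hc1
  · rw [hc1, zero_add] at hc
    refine ⟨?_, c, hc1, hc⟩
    rcases ZMod.eq_zero_or_one (ψ a) with ha1 | ha1
    · exact ⟨a, ha, ha1⟩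
    · exact ⟨a * c, by rw [hχ, ha, hc1, add_zero], by rw [hψ, ha1, hc]; decide⟩
  · have hc2 : ψ c = 0 := by rw [hc1] at hc; simpa using hc
    refine ⟨⟨c, hc1, hc2⟩, ?_⟩
    rcases ZMod.eq_zero_or_one (χ b) with hb1 | hb1
    · exact ⟨b, hb1, hb⟩
    · exact ⟨b * c, by rw [hχ, hb1, hc1]; decide, by rw [hψ, hb, hc2, add_zero]⟩

end QuadChar

/-! ### Quadratic characters of `ℚ_[w]` -/

section Padic

variable {w : ℕ} [Fact w.Prime]

instance : IsGalois ℚ_[w] (PadicAlgCl w) where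

lemma norm_gal (g : Gal(PadicAlgCl w/ℚ_[w])) (x : PadicAlgCl w) : ‖g x‖ = ‖x‖ :=
  (spectralNorm_eq_of_equiv g x).symm

lemma norm_ofNat_two (hw : w ≠ 2) : ‖(2 : PadicAlgCl w)‖ = 1 := by
  have h := PadicAlgCl.norm_extends w (2 : ℚ_[w])
  rw [map_ofNat] at h
  rw [h]
  have := (Padic.norm_natCast_eq_one_iff (p := w) (n := 2)).2
    ((Nat.coprime_primes Fact.out Nat.prime_two).2 hw)
  exact_mod_cast this

lemma norm_sub_lt {x y : PadicAlgCl w} {r : ℝ} (hx : ‖x‖ < r) (hy : ‖y‖ < r) : ‖x - y‖ < r := by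
  have h := IsUltrametricDist.norm_add_le_max x (-y)
  rw [norm_neg, ← sub_eq_add_neg] at h
  exact h.trans_lt (max_lt hx hy)

lemma norm_sub_le {x y : PadicAlgCl w} {r : ℝ} (hx : ‖x‖ ≤ r) (hy : ‖y‖ ≤ r) : ‖x - y‖ ≤ r := by
  have h := IsUltrametricDist.norm_add_le_max x (-y)
  rw [norm_neg, ← sub_eq_add_neg] at h
  exact h.trans (max_le hx hy)

lemma IsSqrt.of_sq_eq {x : PadicAlgCl w} {d : ℚ_[w]} (hd : d ≠ 0) (h : x ^ 2 = algebraMap _ _ d) :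
    IsSqrt ℚ_[w] x := by
  refine ⟨?_, fun g => by rw [h, AlgEquiv.commutes]⟩
  rintro rfl
  rw [zero_pow two_ne_zero, eq_comm, map_eq_zero] at h
  exact hd h

lemma IsSqrt.exists_sq_eq {x : PadicAlgCl w} (h : IsSqrt ℚ_[w] x) :
    ∃ d : ℚ_[w], d ≠ 0 ∧ x ^ 2 = algebraMap _ _ d := by
  obtain ⟨d, hd⟩ := (InfiniteGalois.mem_range_algebraMap_iff_fixed _).2 h.sq
  refine ⟨d, ?_, hd.symm⟩
  rintro rfl
  rw [map_zero, eq_comm] at hd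
  exact h.ne_zero (pow_eq_zero_iff two_ne_zero |>.1 hd)

/-- A unit square root congruent to an element of `ℚ_[w]` is fixed by the Galois group. -/
lemma IsSqrt.fixed_of_norm_sub_lt (hw : w ≠ 2) {x : PadicAlgCl w} (h : IsSqrt ℚ_[w] x)
    (hx : ‖x‖ = 1) {a : ℚ_[w]} (ha : ‖x - algebraMap _ _ a‖ < 1) (g : Gal(PadicAlgCl w/ℚ_[w])) :
    g x = x := by
  rcases h.eq_or g with h1 | h1
  · exact h1
  -- If `g x = -x`, both `x` and `-x` are congruent to `a`, so `2 * x` has norm less than `1`,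
  -- although `2` and `x` are units.
  exfalso
  have h2 : ‖g (x - algebraMap _ _ a)‖ < 1 := by rwa [norm_gal]
  rw [map_sub, AlgEquiv.commutes, h1] at h2
  have h3 := norm_sub_lt ha h2
  have h4 : x - algebraMap _ _ a - (-x - algebraMap _ _ a) = 2 * x := by ring
  rw [h4, norm_mul, norm_ofNat_two hw, hx] at h3
  norm_num at h3

/-- One factor of `(x - a) * (x + a)` has norm less than `1`, so `x` is congruent to `a` or to `-a`.
This plays the role of Hensel's lemma for square roots of units. -/
lemma IsSqrt.fixed_of_norm_sq_sub_lt (hw : w ≠ 2) {x : PadicAlgCl w} (h : IsSqrt ℚ_[w] x)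
    (hx : ‖x‖ = 1) {a : ℚ_[w]} (ha : ‖x ^ 2 - algebraMap _ _ (a ^ 2)‖ < 1)
    (g : Gal(PadicAlgCl w/ℚ_[w])) : g x = x := by
  have h1 : x ^ 2 - algebraMap _ _ (a ^ 2) =
      (x - algebraMap _ _ a) * (x - algebraMap _ _ (-a)) := by
    rw [map_pow, map_neg]; ring
  rw [h1, norm_mul] at ha
  rcases lt_or_ge ‖x - algebraMap ℚ_[w] _ a‖ 1 with h2 | h2
  · exact h.fixed_of_norm_sub_lt hw hx h2 g
  · refine h.fixed_of_norm_sub_lt hw hx (a := -a) ?_ g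
    by_contra! h3
    exact absurd ha (not_lt.2 (one_le_mul_of_one_le_of_one_le h2 h3))

lemma exists_norm_sub_sq_lt_of_isSquare {v : ℤ_[w]} (hv : IsSquare (PadicInt.toZMod v)) :
    ∃ a : ℤ_[w], ‖v - a ^ 2‖ < 1 := by
  obtain ⟨b, hb⟩ := hv
  obtain ⟨a, rfl⟩ := ZMod.ringHom_surjective PadicInt.toZMod b
  refine ⟨a, ?_⟩
  rw [← PadicInt.mem_nonunits, ← IsLocalRing.mem_maximalIdeal, ← PadicInt.ker_toZMod,
    RingHom.mem_ker, map_sub, map_pow, hb, sq, sub_self]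

lemma isSquare_mul_of_not_isSquare {a b : ZMod w} (ha : ¬IsSquare a)
    (hb : ¬IsSquare b) : IsSquare (a * b) := by
  have ha0 : a ≠ 0 := by rintro rfl; exact ha ⟨0, by simp⟩
  have hb0 : b ≠ 0 := by rintro rfl; exact hb ⟨0, by simp⟩
  rw [← quadraticChar_one_iff_isSquare (mul_ne_zero ha0 hb0), map_mul,
    (quadraticChar_neg_one_iff_not_isSquare).2 ha, (quadraticChar_neg_one_iff_not_isSquare).2 hb]
  norm_num

/-- The characters of a uniformizer and of a nonsquare unit span all quadratic characters. -/
lemma padic_quadChar_span (hw : w ≠ 2) {ϖ δ : PadicAlgCl w} (hϖ : ϖ ^ 2 = (w : PadicAlgCl w))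
    {D : ℚ_[w]} (hD : ‖D‖ = 1) (hδ : δ ^ 2 = algebraMap _ _ D)
    (hδg : ∃ g : Gal(PadicAlgCl w/ℚ_[w]), g δ ≠ δ)
    (f : Gal(PadicAlgCl w/ℚ_[w]) → ZMod 2) (hf : IsLocallyConstant f)
    (hmul : ∀ g h, f (g * h) = f g + f h) :
    ∃ x y : ZMod 2, ∀ g, f g = x * quadChar ϖ g + y * quadChar δ g := by
  have hw0 : (w : ℚ_[w]) ≠ 0 := Nat.cast_ne_zero.2 (Fact.out : w.Prime).ne_zero
  have hD0 : D ≠ 0 := by rintro rfl; simp at hD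
  have hϖs : IsSqrt ℚ_[w] ϖ := .of_sq_eq hw0 (by rw [hϖ, map_natCast])
  have hδs : IsSqrt ℚ_[w] δ := .of_sq_eq hD0 hδ
  have norm_one {x : PadicAlgCl w} {v : ℚ_[w]} (hv : ‖v‖ = 1) (h : x ^ 2 = algebraMap _ _ v) :
      ‖x‖ = 1 := by
    have := congrArg norm h
    rw [norm_pow, PadicAlgCl.norm_extends, hv] at this
    exact (pow_eq_one_iff_of_nonneg (norm_nonneg _) two_ne_zero).1 this
  have fixed {x : PadicAlgCl w} {v : ℤ_[w]} (hv : ‖v‖ = 1) (h : x ^ 2 = algebraMap _ _ (v : ℚ_[w]))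
      (hsq : IsSquare (PadicInt.toZMod v)) (g : Gal(PadicAlgCl w/ℚ_[w])) : g x = x := by
    have hv0 : (v : ℚ_[w]) ≠ 0 := by rw [← norm_ne_zero_iff, ← PadicInt.norm_def, hv]; simp
    obtain ⟨a, ha⟩ := exists_norm_sub_sq_lt_of_isSquare hsq
    refine (IsSqrt.of_sq_eq hv0 h).fixed_of_norm_sq_sub_lt hw (norm_one hv h) (a := (a : ℚ_[w])) ?_ g
    rw [h, ← map_sub, PadicAlgCl.norm_extends]
    exact_mod_cast ha
  obtain ⟨θ, hθ, rfl⟩ := exists_eq_quadChar f hf hmul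
  obtain ⟨d, hd0, hd⟩ := hθ.exists_sq_eq
  -- A unit `v` that is a square modulo `w` gives the trivial character. Otherwise `v * D` is a
  -- product of two nonsquares modulo `w`, so `θ` and `δ` have the same character.
  have unit_case : ∀ (θ : PadicAlgCl w) (v : ℚ_[w]), ‖v‖ = 1 → θ ^ 2 = algebraMap _ _ v →
      ∃ y : ZMod 2, ∀ g : Gal(PadicAlgCl w/ℚ_[w]), quadChar θ g = y * quadChar δ g := by
    intro θ v hv hθv
    have hv0 : v ≠ 0 := by rintro rfl; simp at hv
    have hθs : IsSqrt ℚ_[w] θ := .of_sq_eq hv0 hθv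
    let v' : ℤ_[w] := ⟨v, hv.le⟩
    let D' : ℤ_[w] := ⟨D, hD.le⟩
    by_cases hsq : IsSquare (PadicInt.toZMod v')
    · refine ⟨0, fun g => ?_⟩
      rw [zero_mul, quadChar_eq_zero]
      exact fixed (v := v') hv hθv hsq g
    · have hDsq : ¬IsSquare (PadicInt.toZMod D') := by
        intro hDsq
        obtain ⟨g, hg⟩ := hδg
        exact hg (fixed (v := D') hD hδ hDsq g)
      refine ⟨1, fun g => ?_⟩
      have h1 := fixed (x := θ * δ) (v := v' * D')
        (by rw [norm_mul]; change ‖v‖ * ‖D‖ = 1; rw [hv, hD, one_mul])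
        (by rw [mul_pow, hθv, hδ, ← map_mul]; rfl)
        (by rw [map_mul]; exact isSquare_mul_of_not_isSquare hsq hDsq) g
      rw [← quadChar_eq_zero, hθs.quadChar_mul hδs] at h1
      rw [one_mul, CharTwo.add_eq_zero.1 h1]
  have hwn : (w : ℚ_[w]) ^ (d.valuation / 2) ≠ 0 := zpow_ne_zero _ hw0
  have hdn := Padic.norm_eq_zpow_neg_valuation hd0
  have hwn1 : ‖(w : ℚ_[w])‖ = (w : ℝ) ^ (-1 : ℤ) := by rw [Padic.norm_p, zpow_neg_one]
  have hwR : (w : ℝ) ≠ 0 := Nat.cast_ne_zero.2 (Fact.out : w.Prime).ne_zero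
  have scale (θ : PadicAlgCl w) (c : ℚ_[w]) (hc : c ≠ 0) (g : Gal(PadicAlgCl w/ℚ_[w])) :
      quadChar (algebraMap _ _ c * θ) g = quadChar θ g := by
    have hc' : algebraMap ℚ_[w] (PadicAlgCl w) c ≠ 0 := by simpa
    rw [quadChar, quadChar, map_mul, AlgEquiv.commutes, mul_right_inj' hc']
  -- For odd valuation `θ` is first multiplied by `ϖ`. The valuation of `d * w` is even, and half of
  -- it is `d.valuation / 2 + 1`.
  rcases Int.emod_two_eq_zero_or_one d.valuation with hpar | hpar
  · obtain ⟨y, hy⟩ := unit_case (algebraMap _ _ ((w : ℚ_[w]) ^ (d.valuation / 2))⁻¹ * θ)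
      ((((w : ℚ_[w]) ^ (d.valuation / 2))⁻¹) ^ 2 * d) (by
        rw [norm_mul, norm_pow, norm_inv, norm_zpow, hwn1, hdn, ← zpow_mul, ← zpow_neg,
          ← zpow_natCast, ← zpow_mul, ← zpow_add₀ hwR, zpow_eq_one_iff_right₀ (by positivity) (by exact_mod_cast (Fact.out : w.Prime).ne_one)]
        push_cast
        omega) (by rw [mul_pow, hd, map_mul, map_pow])
    refine ⟨0, y, fun g => ?_⟩
    rw [zero_mul, zero_add, ← hy, scale _ _ (inv_ne_zero hwn)]
  · obtain ⟨y, hy⟩ := unit_case (algebraMap _ _ ((w : ℚ_[w]) ^ (d.valuation / 2 + 1))⁻¹ * (θ * ϖ))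
      ((((w : ℚ_[w]) ^ (d.valuation / 2 + 1))⁻¹) ^ 2 * (d * w)) (by
        rw [norm_mul, norm_pow, norm_inv, norm_zpow, norm_mul, hwn1, hdn, ← zpow_mul, ← zpow_neg,
          ← zpow_natCast, ← zpow_mul, ← zpow_add₀ hwR, ← zpow_add₀ hwR,
          zpow_eq_one_iff_right₀ (by positivity) (by exact_mod_cast (Fact.out : w.Prime).ne_one)]
        push_cast
        omega) (by rw [mul_pow, mul_pow, hd, hϖ, map_mul, map_mul, map_pow, map_natCast])
    refine ⟨1, y, fun g => ?_⟩
    have h1 := hy g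
    rw [scale _ _ (inv_ne_zero (zpow_ne_zero _ hw0)), hθ.quadChar_mul hϖs] at h1
    rw [one_mul, ← h1, add_comm, add_assoc, CharTwo.add_self_eq_zero, add_zero]

/-- A square root of a uniformizer is not fixed by the Galois group. -/
lemma exists_gal_ne_of_sq_eq {x : PadicAlgCl w} {u : ℚ_[w]} (hu : ‖u‖ = 1)
    (hx : x ^ 2 = algebraMap _ _ (w * u)) : ∃ g : Gal(PadicAlgCl w/ℚ_[w]), g x ≠ x := by
  by_contra! h
  obtain ⟨c, rfl⟩ := (InfiniteGalois.mem_range_algebraMap_iff_fixed _).2 h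
  rw [← map_pow] at hx
  have hc := (algebraMap ℚ_[w] (PadicAlgCl w)).injective hx
  have hw1 : (1 : ℝ) < w := by exact_mod_cast (Fact.out : w.Prime).one_lt
  have hc0 : c ≠ 0 := by
    rintro rfl
    have hn := congrArg norm hc
    simp only [zero_pow two_ne_zero, norm_zero, norm_mul, hu, mul_one, eq_comm (a := (0 : ℝ)),
      norm_eq_zero, Nat.cast_eq_zero] at hn
    exact (Fact.out : w.Prime).ne_zero hn
  have hn := congrArg norm hc
  rw [norm_pow, norm_mul, hu, mul_one, Padic.norm_p, Padic.norm_eq_zpow_neg_valuation hc0,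
    ← zpow_natCast, ← zpow_mul, ← zpow_neg_one, zpow_right_inj₀ (by positivity) hw1.ne'] at hn
  push_cast at hn
  omega

/-- The sum of the two characters belongs to `ϖ * δ`, whose square is again a uniformizer, so it is
nontrivial and `exists_separating` applies. -/
lemma padic_separating {ϖ δ : PadicAlgCl w} (hϖ : ϖ ^ 2 = (w : PadicAlgCl w))
    {D : ℚ_[w]} (hD : ‖D‖ = 1) (hδ : δ ^ 2 = algebraMap _ _ D)
    (hδg : ∃ g : Gal(PadicAlgCl w/ℚ_[w]), g δ ≠ δ) :
    (∃ g : Gal(PadicAlgCl w/ℚ_[w]), quadChar ϖ g = 1 ∧ quadChar δ g = 0) ∧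
      ∃ g : Gal(PadicAlgCl w/ℚ_[w]), quadChar ϖ g = 0 ∧ quadChar δ g = 1 := by
  have hw0 : (w : ℚ_[w]) ≠ 0 := Nat.cast_ne_zero.2 (Fact.out : w.Prime).ne_zero
  have hD0 : D ≠ 0 := by rintro rfl; simp at hD
  have hϖs : IsSqrt ℚ_[w] ϖ := .of_sq_eq hw0 (by rw [hϖ, map_natCast])
  have hδs : IsSqrt ℚ_[w] δ := .of_sq_eq hD0 hδ
  refine exists_separating hϖs.quadChar_mul_apply hδs.quadChar_mul_apply ?_ ?_ ?_
  · simp_rw [quadChar_eq_one]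
    exact exists_gal_ne_of_sq_eq (u := 1) norm_one (by rw [hϖ, mul_one, map_natCast])
  · simpa only [quadChar_eq_one] using hδg
  · simp_rw [← hϖs.quadChar_mul hδs, quadChar_eq_one]
    exact exists_gal_ne_of_sq_eq hD (by rw [mul_pow, hϖ, hδ, map_mul, map_natCast])

/-- There is a unit whose square root is not fixed by the Galois group. -/
lemma exists_nonsquare_unit (hw : w ≠ 2) : ∃ (D : ℚ_[w]) (δ : PadicAlgCl w), ‖D‖ = 1 ∧
    δ ^ 2 = algebraMap _ _ D ∧ ∃ g : Gal(PadicAlgCl w/ℚ_[w]), g δ ≠ δ := by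
  obtain ⟨a, ha⟩ := FiniteField.exists_nonsquare (F := ZMod w) (by rwa [ZMod.ringChar_zmod_n])
  obtain ⟨v, rfl⟩ := ZMod.ringHom_surjective PadicInt.toZMod a
  obtain ⟨δ, hδ⟩ := IsAlgClosed.exists_pow_nat_eq (algebraMap ℚ_[w] (PadicAlgCl w) v) two_pos
  refine ⟨v, δ, ?_, hδ, ?_⟩
  · refine le_antisymm v.2 (not_lt.1 fun h => ha ?_)
    have hv : v ∈ RingHom.ker (PadicInt.toZMod (p := w)) := by
      rw [PadicInt.ker_toZMod, IsLocalRing.mem_maximalIdeal, PadicInt.mem_nonunits]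
      exact h
    rw [RingHom.mem_ker] at hv
    rw [hv]
    exact ⟨0, by simp⟩
  · by_contra! h
    obtain ⟨c, rfl⟩ := (InfiniteGalois.mem_range_algebraMap_iff_fixed _).2 h
    rw [← map_pow] at hδ
    have hc := (algebraMap ℚ_[w] (PadicAlgCl w)).injective hδ
    have hc1 : ‖c‖ ≤ 1 := by
      rw [← pow_le_one_iff_of_nonneg (norm_nonneg _) two_ne_zero, ← norm_pow, hc]
      exact v.2
    let c' : ℤ_[w] := ⟨c, hc1⟩
    have hv : v = c' * c' := Subtype.ext (by rw [← hc, sq]; rfl)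
    exact ha ⟨PadicInt.toZMod c', by rw [← map_mul, ← hv]⟩

end Padic

/-! ### Frobenius elements and good reduction -/

section Frobenius

variable {w : ℕ} [Fact w.Prime]

variable (w) in
/-- The ring of integers of the algebraic closure of `ℚ_[w]`. -/
def algClIntegers : ValuationSubring (PadicAlgCl w) where
  carrier := {x | ‖x‖ ≤ 1}
  mul_mem' {a b} ha hb := by
    rw [Set.mem_ofPred_eq, norm_mul]
    exact mul_le_one₀ ha (norm_nonneg b) hb
  one_mem' := norm_one.le
  add_mem' ha hb := (IsUltrametricDist.norm_add_le_max _ _).trans (max_le ha hb)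
  zero_mem' := by simp
  neg_mem' {x} hx := by rwa [Set.mem_ofPred_eq, norm_neg]
  mem_or_inv_mem' x := by
    change ‖x‖ ≤ 1 ∨ ‖x⁻¹‖ ≤ 1
    rcases le_total ‖x‖ 1 with h | h
    · exact .inl h
    · right
      rw [norm_inv]
      exact inv_le_one_of_one_le₀ h

lemma residue_algClIntegers_eq_zero_iff (x : algClIntegers w) :
    IsLocalRing.residue (algClIntegers w) x = 0 ↔ ‖(x : PadicAlgCl w)‖ < 1 := by
  rw [IsLocalRing.residue_eq_zero_iff, IsLocalRing.mem_maximalIdeal, mem_nonunits_iff,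
    ← not_le, not_iff_not]
  constructor
  · rintro ⟨u, rfl⟩
    have h1 : (((u⁻¹ : (algClIntegers w)ˣ) : algClIntegers w) : PadicAlgCl w) *
        ((u : algClIntegers w) : PadicAlgCl w) = 1 := by
      have := congrArg (Subtype.val : algClIntegers w → PadicAlgCl w) u.inv_mul
      exact this
    have h2 : ‖(((u⁻¹ : (algClIntegers w)ˣ) : algClIntegers w) : PadicAlgCl w)‖ ≤ 1 := (u⁻¹).1.2
    have h3 := congrArg norm h1
    rw [norm_mul, norm_one] at h3
    nlinarith [norm_nonneg ((u : algClIntegers w) : PadicAlgCl w)]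
  · intro h
    have hx0 : (x : PadicAlgCl w) ≠ 0 := by
      intro h0
      rw [h0, norm_zero] at h
      norm_num at h
    have hinv : ‖(x : PadicAlgCl w)⁻¹‖ ≤ 1 := by
      rw [norm_inv]
      exact inv_le_one_of_one_le₀ h
    exact IsUnit.of_mul_eq_one (⟨_, hinv⟩ : algClIntegers w) (Subtype.ext (mul_inv_cancel₀ hx0))

/-- An integral element fixed by a Frobenius is congruent to a rational integer. -/
lemma exists_norm_sub_intCast_lt {x : PadicAlgCl w} (hx : ‖x‖ ≤ 1) (h : ‖x - x ^ w‖ < 1) :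
    ∃ a : ℤ, ‖x - a‖ < 1 := by
  let R := algClIntegers w
  let x' : R := ⟨x, hx⟩
  have hw0 : (w : IsLocalRing.ResidueField R) = 0 := by
    rw [← map_natCast (IsLocalRing.residue R), residue_algClIntegers_eq_zero_iff]
    have h1 := PadicAlgCl.norm_extends w (w : ℚ_[w])
    rw [map_natCast] at h1
    have h2 : (((w : R) : PadicAlgCl w)) = (w : PadicAlgCl w) := rfl
    rw [h2, h1]
    exact Padic.norm_p_lt_one
  have : CharP (IsLocalRing.ResidueField R) w :=
    (CharP.charP_iff_prime_eq_zero Fact.out).2 hw0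
  have hpow : IsLocalRing.residue R x' ^ w = IsLocalRing.residue R x' := by
    rw [← map_pow, eq_comm, ← sub_eq_zero, ← map_sub, residue_algClIntegers_eq_zero_iff]
    exact h
  -- The residue class is a root of `X ^ w = X`, hence lies in the prime field.
  rw [← Subfield.mem_bot_iff_pow_eq_self, mem_bot_iff_intCast w] at hpow
  obtain ⟨a, ha⟩ := hpow
  refine ⟨a, ?_⟩
  rw [← map_intCast (IsLocalRing.residue R), eq_comm, ← sub_eq_zero, ← map_sub,
    residue_algClIntegers_eq_zero_iff] at ha
  exact ha

end Frobenius

/-! ### Integrality and incongruence of the roots at good primes. -/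

section GoodReduction

open WeierstrassCurve

variable {w : ℕ} [Fact w.Prime]

/-- The change of variables leads to a minimal model: its invariants come from `ℤ_[w]`, and good
reduction keeps the discriminant out of the maximal ideal. -/
lemma GoodReductionAt.exists_variableChange {E : WeierstrassCurve ℚ} (h : GoodReductionAt E w) :
    ∃ C : VariableChange ℚ_[w], ‖(C • E.baseChange ℚ_[w]).b₂‖ ≤ 1 ∧
      ‖(C • E.baseChange ℚ_[w]).b₄‖ ≤ 1 ∧ ‖(C • E.baseChange ℚ_[w]).b₆‖ ≤ 1 ∧
      ‖(C • E.baseChange ℚ_[w]).Δ‖ = 1 := by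
  refine ⟨((E.baseChange ℚ_[w]).exists_isMinimal ℤ_[w]).choose, ?_⟩
  change let V := (E.baseChange ℚ_[w]).minimal ℤ_[w]; ‖V.b₂‖ ≤ 1 ∧ ‖V.b₄‖ ≤ 1 ∧ ‖V.b₆‖ ≤ 1 ∧ ‖V.Δ‖ = 1
  intro V
  have hint (a : ℤ_[w]) : ‖algebraMap ℤ_[w] ℚ_[w] a‖ ≤ 1 := a.2
  refine ⟨integralModel_b₂_eq ℤ_[w] V ▸ hint _, integralModel_b₄_eq ℤ_[w] V ▸ hint _,
    integralModel_b₆_eq ℤ_[w] V ▸ hint _, ?_⟩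
  have hΔ := h.goodReduction
  change (IsDedekindDomain.HeightOneSpectrum.valuation ℚ_[w]
    (IsDiscreteValuationRing.maximalIdeal ℤ_[w])) V.Δ = 1 at hΔ
  rw [← integralModel_Δ_eq ℤ_[w] V] at hΔ ⊢
  refine le_antisymm (hint _) (not_lt.1 fun hlt => hΔ.not_lt ?_)
  rw [IsDedekindDomain.HeightOneSpectrum.valuation_lt_one_iff_mem]
  change _ ∈ IsLocalRing.maximalIdeal ℤ_[w]
  rw [IsLocalRing.mem_maximalIdeal, PadicInt.mem_nonunits]
  exact hlt

/-- Under a change of variables the roots of the 2-division polynomial are translated and scaled. -/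
lemma IsRoots.variableChange {K L : Type*} [Field K] [Field L] [Algebra K L]
    {W : WeierstrassCurve K} {α β γ : L} (h : IsRoots (W.baseChange L) α β γ)
    (C : VariableChange K) :
    IsRoots ((C • W).baseChange L)
      ((α - algebraMap K L C.r) / algebraMap K L C.u ^ 2)
      ((β - algebraMap K L C.r) / algebraMap K L C.u ^ 2)
      ((γ - algebraMap K L C.r) / algebraMap K L C.u ^ 2) := by
  have hu : algebraMap K L C.u ≠ 0 := by simp
  obtain ⟨h2, h4, h6⟩ := h
  simp only [baseChange, map_b₂, map_b₄, map_b₆] at h2 h4 h6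
  constructor
  · simp only [baseChange, map_b₂, variableChange_b₂, map_mul, map_pow, map_add, map_ofNat, h2,
      Units.val_inv_eq_inv_val, map_inv₀]
    field_simp
    ring
  · simp only [baseChange, map_b₄, variableChange_b₄, map_mul, map_pow, map_add, map_ofNat, h2, h4,
      Units.val_inv_eq_inv_val, map_inv₀]
    field_simp
    ring
  · simp only [baseChange, map_b₆, variableChange_b₆, map_mul, map_pow, map_add, map_ofNat, h2, h4,
      h6, Units.val_inv_eq_inv_val, map_inv₀]
    field_simp
    ring

/-- Since `4` is a unit, for `‖α‖ > 1` the term `4 * α ^ 3` would strictly dominate the others. -/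
lemma IsRoots.norm_le_one (hw : w ≠ 2) {V : WeierstrassCurve (PadicAlgCl w)}
    {α β γ : PadicAlgCl w} (h : IsRoots V α β γ) (h2 : ‖V.b₂‖ ≤ 1) (h4 : ‖V.b₄‖ ≤ 1)
    (h6 : ‖V.b₆‖ ≤ 1) : ‖α‖ ≤ 1 := by
  by_contra! hα
  have hroot := h.isDivRoot
  rw [IsDivRoot] at hroot
  have e : (2 * 2) * α ^ 3 = -(V.b₂ * α ^ 2 + 2 * V.b₄ * α + V.b₆) := by linear_combination hroot
  have hn := congrArg norm e
  have n2 := norm_ofNat_two hw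
  rw [norm_neg, norm_mul, norm_mul, n2, norm_pow, one_mul, one_mul] at hn
  have b1 : ‖V.b₂ * α ^ 2‖ ≤ ‖α‖ ^ 2 := by
    rw [norm_mul, norm_pow]
    exact mul_le_of_le_one_left (by positivity) h2
  have b2 : ‖2 * V.b₄ * α‖ ≤ ‖α‖ ^ 2 := by
    rw [norm_mul, norm_mul, n2, one_mul]
    nlinarith [norm_nonneg V.b₄]
  have b3 : ‖V.b₆‖ ≤ ‖α‖ ^ 2 := h6.trans (one_le_pow₀ hα.le)
  have b4 : ‖V.b₂ * α ^ 2 + 2 * V.b₄ * α + V.b₆‖ ≤ ‖α‖ ^ 2 :=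
    (IsUltrametricDist.norm_add_le_max _ _).trans
      (max_le ((IsUltrametricDist.norm_add_le_max _ _).trans (max_le b1 b2)) b3)
  rw [← hn] at b4
  exact absurd b4 (not_le.2 (pow_lt_pow_right₀ hα (by norm_num)))

/-- At an odd prime of good reduction, the roots of the 2-division polynomial can be normalized
to be integral and pairwise incongruent. -/
lemma GoodReductionAt.exists_normalization (hw : w ≠ 2) {E : WeierstrassCurve ℚ}
    (hE : GoodReductionAt E w) : ∃ r u : ℚ_[w], u ≠ 0 ∧ ∀ α β γ : PadicAlgCl w,
      IsRoots ((E.baseChange ℚ_[w]).baseChange (PadicAlgCl w)) α β γ →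
        ‖(α - algebraMap _ _ r) / algebraMap _ _ u‖ ≤ 1 ∧
        ‖(α - β) / algebraMap _ _ u‖ = 1 := by
  obtain ⟨C, h2, h4, h6, hΔ⟩ := hE.exists_variableChange
  refine ⟨C.r, C.u ^ 2, by simp, fun α β γ h => ?_⟩
  have h' := h.variableChange C
  rw [← map_pow] at h'
  set V := (C • E.baseChange ℚ_[w]).baseChange (PadicAlgCl w) with hV
  have h2' : ‖V.b₂‖ ≤ 1 := by
    rwa [hV, baseChange, map_b₂, PadicAlgCl.norm_extends]
  have h4' : ‖V.b₄‖ ≤ 1 := by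
    rwa [hV, baseChange, map_b₄, PadicAlgCl.norm_extends]
  have h6' : ‖V.b₆‖ ≤ 1 := by
    rwa [hV, baseChange, map_b₆, PadicAlgCl.norm_extends]
  have hΔ' : ‖V.Δ‖ = 1 := by
    rwa [hV, baseChange, map_Δ, PadicAlgCl.norm_extends]
  have hα := h'.norm_le_one hw h2' h4' h6'
  have hβ := h'.swap₁₂.norm_le_one hw h2' h4' h6'
  have hγ := h'.swap₂₃.swap₁₂.norm_le_one hw h2' h4' h6'
  refine ⟨hα, ?_⟩
  -- Up to the unit `16`, the discriminant is the square of the product of the three differences.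
  -- These have norm at most `1`, so a product of norm `1` forces each norm to be `1`.
  rw [h'.discr] at hΔ'
  set a := (α - algebraMap _ _ C.r) / algebraMap ℚ_[w] (PadicAlgCl w) (C.u ^ 2)
  set b := (β - algebraMap _ _ C.r) / algebraMap ℚ_[w] (PadicAlgCl w) (C.u ^ 2)
  set c := (γ - algebraMap _ _ C.r) / algebraMap ℚ_[w] (PadicAlgCl w) (C.u ^ 2)
  have e : (α - β) / algebraMap ℚ_[w] (PadicAlgCl w) (C.u ^ 2) = a - b := by
    simp only [a, b]
    rw [← sub_div]
    congr 1
    ring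
  have n16 : ‖(16 : PadicAlgCl w)‖ = 1 := by
    have : (16 : PadicAlgCl w) = 2 ^ 4 := by norm_num
    rw [this, norm_pow, norm_ofNat_two hw, one_pow]
  rw [norm_mul, n16, one_mul, norm_pow,
    pow_eq_one_iff_of_nonneg (norm_nonneg _) two_ne_zero, norm_mul, norm_mul] at hΔ'
  rw [e]
  have h1 := norm_sub_le hα hβ
  have h2 := norm_sub_le hα hγ
  have h3 := norm_sub_le hβ hγ
  refine le_antisymm h1 ?_
  rw [← hΔ', mul_assoc]
  exact mul_le_of_le_one_right (norm_nonneg _) (mul_le_one₀ h2 (norm_nonneg _) h3)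

end GoodReduction

/-! ### The local theorem -/

section Local

open WeierstrassCurve

variable {E : WeierstrassCurve ℚ} {w : ℕ} [Fact w.Prime] {α β γ : PadicAlgCl w}

/-- At an odd prime of good reduction, a root of the 2-division polynomial fixed by a Frobenius is
fixed by the whole decomposition group. -/
lemma gal_root_eq (hw : w ≠ 2) (hE : GoodReductionAt E w)
    (h : IsRoots ((E.baseChange ℚ_[w]).baseChange (PadicAlgCl w)) α β γ)
    {σ : Gal(PadicAlgCl w/ℚ_[w])} (hσ : ∀ x : PadicAlgCl w, ‖x‖ ≤ 1 → ‖σ x - x ^ w‖ < 1)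
    (hα : σ α = α) (g : Gal(PadicAlgCl w/ℚ_[w])) : g α = α := by
  obtain ⟨r, u, hu, hru⟩ := hE.exists_normalization hw
  have hint := (hru α β γ h).1
  have h1 := hσ _ hint
  have hfix : σ ((α - algebraMap _ _ r) / algebraMap _ _ u) =
      (α - algebraMap _ _ r) / algebraMap _ _ u := by
    rw [map_div₀, map_sub, hα, AlgEquiv.commutes, AlgEquiv.commutes]
  rw [hfix] at h1
  -- The normalized root is congruent to an integer, a congruence that `g` preserves. So `g α` and
  -- `α` are congruent after normalization, while distinct roots are not.
  obtain ⟨a, ha⟩ := exists_norm_sub_intCast_lt hint h1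
  have hga : ‖g ((α - algebraMap _ _ r) / algebraMap _ _ u - a)‖ < 1 := by rwa [norm_gal]
  have hsub := norm_sub_lt ha hga
  rw [map_sub, map_div₀, map_sub, AlgEquiv.commutes, AlgEquiv.commutes, map_intCast] at hsub
  have e : (α - algebraMap _ _ r) / algebraMap _ _ u - a -
      ((g α - algebraMap _ _ r) / algebraMap _ _ u - a) =
      (α - g α) / algebraMap ℚ_[w] (PadicAlgCl w) u := by ring
  rw [e] at hsub
  rcases (h.isDivRoot.gal g).eq_or h with h2 | h2 | h2
  · exact h2
  · rw [h2, (hru α β γ h).2] at hsub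
    exact absurd hsub (lt_irrefl _)
  · rw [h2, (hru α γ β h.swap₂₃).2] at hsub
    exact absurd hsub (lt_irrefl _)

lemma exists_sqrt_uniformizer : ∃ ϖ : PadicAlgCl w, ϖ ^ 2 = (w : PadicAlgCl w) :=
  IsAlgClosed.exists_pow_nat_eq _ two_pos

/-- If the Galois group acts trivially on `E[2]`, then `H¹(ℚ_w, E[2])` is not two-dimensional. -/
lemma finrank_H1_ne_two_of_trivial (hw : w ≠ 2) {W : WeierstrassCurve ℚ_[w]} [W.IsElliptic]
    (b : Module.Basis (Fin 2) (ZMod 2) (E2 W (PadicAlgCl w)))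
    (htriv : ∀ g P, galE2 W (PadicAlgCl w) g P = P) :
    Module.finrank (ZMod 2) (H1 (galE2 W (PadicAlgCl w))) ≠ 2 := by
  intro hdim
  have : FiniteDimensional (ZMod 2) (H1 (galE2 W (PadicAlgCl w))) :=
    Module.finite_of_finrank_eq_succ hdim
  obtain ⟨ϖ, hϖ⟩ := exists_sqrt_uniformizer (w := w)
  obtain ⟨D, δ, hD, hδ, hδg⟩ := exists_nonsquare_unit hw
  have hw0 : (w : ℚ_[w]) ≠ 0 := Nat.cast_ne_zero.2 (Fact.out : w.Prime).ne_zero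
  have hD0 : D ≠ 0 := by rintro rfl; simp at hD
  have hϖs : IsSqrt ℚ_[w] ϖ := .of_sq_eq hw0 (by rw [hϖ, map_natCast])
  have hδs : IsSqrt ℚ_[w] δ := .of_sq_eq hD0 hδ
  obtain ⟨⟨g₁, hϖ₁, hδ₁⟩, g₀, hϖ₀, hδ₀⟩ := padic_separating hϖ hD hδ hδg
  -- For the trivial action all coboundaries vanish, so cocycles may be compared pointwise. Three
  -- independent ones already exceed dimension two.
  let z : Fin 3 → Z1 (galE2 W (PadicAlgCl w)) :=
    ![charCocycle W (PadicAlgCl w) _ (quadChar_lc ϖ) hϖs.quadChar_mul_apply (b 0) fun g => htriv g _,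
      charCocycle W (PadicAlgCl w) _ (quadChar_lc ϖ) hϖs.quadChar_mul_apply (b 1) fun g => htriv g _,
      charCocycle W (PadicAlgCl w) _ (quadChar_lc δ) hδs.quadChar_mul_apply (b 0) fun g => htriv g _]
  have hli : LinearIndependent (ZMod 2)
      fun i => (Submodule.Quotient.mk (z i) : H1 (galE2 W (PadicAlgCl w))) := by
    rw [Fintype.linearIndependent_iff]
    intro a ha
    simp only [Fin.sum_univ_three, ← Submodule.Quotient.mk_smul] at ha
    rw [← Submodule.Quotient.mk_add, ← Submodule.Quotient.mk_add, H1.mk_eq_zero_iff] at ha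
    obtain ⟨m, hm⟩ := ha
    have hm' (g : Gal(PadicAlgCl w/ℚ_[w])) : 0 = a 0 • quadChar ϖ g • b 0 + a 1 • quadChar ϖ g • b 1 +
        a 2 • quadChar δ g • b 0 := by
      have := hm g
      rw [htriv, sub_self] at this
      exact this
    have e1 := hm' g₁
    have e0 := hm' g₀
    rw [hϖ₁, hδ₁] at e1
    rw [hϖ₀, hδ₀] at e0
    simp only [one_smul, zero_smul, smul_zero, add_zero, zero_add] at e0 e1
    have hb := Fintype.linearIndependent_iff.1 b.linearIndependent ![a 0, a 1]
      (by simpa [Fin.sum_univ_two] using e1.symm)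
    intro i
    fin_cases i
    · exact hb 0
    · exact hb 1
    · exact (smul_eq_zero.1 e0.symm).resolve_right (b.ne_zero 0)
  have := hli.fintype_card_le_finrank
  rw [hdim, Fintype.card_fin] at this
  omega

/-- The local theorem, for a Frobenius fixing the root `α` of the 2-division polynomial. -/
theorem isotropic_of_frobenius_fixed [E.IsElliptic] (k : Type*) [Field k] [Finite k] [Algebra (ZMod 2) k]
    (hw : w ≠ 2) (hE : GoodReductionAt E w)
    (h : IsRoots ((E.baseChange ℚ_[w]).baseChange (PadicAlgCl w)) α β γ)
    {σ : Gal(PadicAlgCl w/ℚ_[w])} (hσ : ∀ x : PadicAlgCl w, ‖x‖ ≤ 1 → ‖σ x - x ^ w‖ < 1)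
    (hα : σ α = α) (hs : ∃ s, s ^ 2 = α - β ∧ σ (σ s) = s)
    (hk : Module.finrank k (H1 (galV (E.baseChange ℚ_[w]) (PadicAlgCl w) k)) = 2) :
    (∃! U : Subrepresentation (galV (E.baseChange ℚ_[w]) (PadicAlgCl w) k),
        Module.finrank k U.toSubmodule = 1) ∧
      (∃! Q, IsScalarExtension (E.baseChange ℚ_[w]) (PadicAlgCl w) k Q) ∧
      ∀ (U : Subrepresentation (galV (E.baseChange ℚ_[w]) (PadicAlgCl w) k))
        (Q : QuadraticForm k (H1 (galV (E.baseChange ℚ_[w]) (PadicAlgCl w) k))),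
        Module.finrank k U.toSubmodule = 1 →
        IsScalarExtension (E.baseChange ℚ_[w]) (PadicAlgCl w) k Q →
        Module.finrank k (imageOfSub _ U) = 1 ∧ ∀ x ∈ imageOfSub _ U, Q x = 0 := by
  have hαg := gal_root_eq hw hE h hσ hα
  have hαβ : α ≠ β := h.ne
  have hαγ : α ≠ γ := h.swap₂₃.ne
  have hβγ : β ≠ γ := h.swap₁₂.swap₂₃.ne
  have hβor (g : Gal(PadicAlgCl w/ℚ_[w])) : g β = β ∨ g β = γ :=
    ((h.swap₁₂.isDivRoot.gal g).eq_or h).resolve_left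
      fun h1 => hαβ (g.injective (h1.trans (hαg g).symm)).symm
  have hγor (g : Gal(PadicAlgCl w/ℚ_[w])) : g γ = β ∨ g γ = γ :=
    ((h.swap₂₃.swap₁₂.isDivRoot.gal g).eq_or h).resolve_left
      fun h1 => hαγ (g.injective (h1.trans (hαg g).symm)).symm
  have hγ_of_fix {g : Gal(PadicAlgCl w/ℚ_[w])} (hg : g β = β) : g γ = γ :=
    (hγor g).resolve_left fun h1 => hβγ (g.injective (h1.trans hg.symm)).symm
  have hγ_of_move {g : Gal(PadicAlgCl w/ℚ_[w])} (hg : g β = γ) : g γ = β :=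
    (hγor g).resolve_right fun h1 => hβγ (g.injective (hg.trans h1.symm))
  have hbα (g : Gal(PadicAlgCl w/ℚ_[w])) : galE2 (E.baseChange ℚ_[w]) (PadicAlgCl w) g
      (torsionBasis h 0) = torsionBasis h 0 := by
    rw [torsionBasis_zero, galE2_torsionPoint]
    simp only [hαg]
  rcases hβor σ with hβ | hβ
  -- If `σ` also fixes `β`, the whole group fixes both basis points, which contradicts the dimension
  -- of `H¹`.
  · exfalso
    rw [finrank_H1_galV] at hk
    have hβg := gal_root_eq hw hE h.swap₁₂ hσ hβ
    refine finrank_H1_ne_two_of_trivial hw (torsionBasis h) (fun g P => ?_) hk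
    have hbβ : galE2 (E.baseChange ℚ_[w]) (PadicAlgCl w) g
        (torsionBasis h 1) = torsionBasis h 1 := by
      rw [torsionBasis_one, galE2_torsionPoint]
      simp only [hβg]
    have hP := (torsionBasis h).sum_repr P
    rw [Fin.sum_univ_two] at hP
    rw [← hP, map_add, map_smul, map_smul, hbα, hbβ]
  obtain ⟨r, u, hu, hru⟩ := hE.exists_normalization hw
  have hu' : algebraMap ℚ_[w] (PadicAlgCl w) u ≠ 0 := by simpa
  have nαβ := (hru α β γ h).2
  have nαγ := (hru α γ β h.swap₂₃).2
  have nβγ := (hru β γ α h.swap₁₂.swap₂₃).2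
  have hγ := hγ_of_move hβ
  -- the unramified quadratic character
  set δ := (β - γ) / algebraMap ℚ_[w] (PadicAlgCl w) u with hδdef
  have hδ0 : δ ≠ 0 := div_ne_zero (sub_ne_zero.2 hβγ) hu'
  have hδfix {g : Gal(PadicAlgCl w/ℚ_[w])} (hg : g β = β) : g δ = δ := by
    rw [hδdef, map_div₀, map_sub, AlgEquiv.commutes, hg, hγ_of_fix hg]
  have hδmove {g : Gal(PadicAlgCl w/ℚ_[w])} (hg : g β = γ) : g δ = -δ := by
    rw [hδdef, map_div₀, map_sub, AlgEquiv.commutes, hg, hγ_of_move hg, ← neg_div, neg_sub]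
  have hδs : IsSqrt ℚ_[w] δ := ⟨hδ0, fun g => by
    rcases hβor g with hg | hg
    · rw [map_pow, hδfix hg]
    · rw [map_pow, hδmove hg, neg_sq]⟩
  obtain ⟨D, hD0, hDδ⟩ := hδs.exists_sq_eq
  have hD : ‖D‖ = 1 := by
    rw [← PadicAlgCl.norm_extends, ← hDδ, norm_pow, nβγ, one_pow]
  have hδg : ∃ g : Gal(PadicAlgCl w/ℚ_[w]), g δ ≠ δ := ⟨σ, by rw [hδmove hβ]; exact hδs.neg_ne⟩
  obtain ⟨ϖ, hϖ⟩ := exists_sqrt_uniformizer (w := w)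
  have hw0 : (w : ℚ_[w]) ≠ 0 := Nat.cast_ne_zero.2 (Fact.out : w.Prime).ne_zero
  have hϖs : IsSqrt ℚ_[w] ϖ := .of_sq_eq hw0 (by rw [hϖ, map_natCast])
  obtain ⟨⟨g₁, hϖ₁, hδ₁⟩, g₀, hϖ₀, hδ₀⟩ := padic_separating hϖ hD hDδ hδg
  have huni : IsUnipotent (galE2 (E.baseChange ℚ_[w]) (PadicAlgCl w)) (torsionBasis h)
      (quadChar δ) := by
    refine ⟨hbα, fun g => ?_⟩
    rw [torsionBasis_one, torsionBasis_zero, galE2_torsionPoint]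
    rcases hβor g with hg | hg
    · rw [quadChar_eq_zero.2 (hδfix hg), zero_smul, add_zero]
      simp only [hg]
    · rw [quadChar_eq_one.2 (by rw [hδmove hg]; exact hδs.neg_ne), one_smul, add_comm,
        torsionPoint_add h]
      simp only [hg]
  -- a square root of `(α - β) * (α - γ)` in `ℚ_[w]`
  obtain ⟨s, hs2, hss⟩ := hs
  -- As `σ` swaps `β` and `γ`, `σ s` is a square root of `α - γ`. Since `σ (σ s) = s`, the product
  -- is fixed by `σ`.
  set t := s * σ s with ht
  have ht2 : t ^ 2 = (α - β) * (α - γ) := by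
    rw [ht, mul_pow, ← map_pow, hs2, map_sub, hα, hβ]
  have ht0 : t ≠ 0 := by
    intro h0
    rw [h0, zero_pow two_ne_zero, eq_comm, mul_eq_zero, sub_eq_zero, sub_eq_zero] at ht2
    exact ht2.elim hαβ hαγ
  have hσt : σ t = t := by rw [ht, map_mul, hss, mul_comm]
  have hts : IsSqrt ℚ_[w] (t / algebraMap ℚ_[w] (PadicAlgCl w) u) := by
    refine ⟨div_ne_zero ht0 hu', fun g => ?_⟩
    rw [div_pow, ht2, map_div₀, map_pow, AlgEquiv.commutes, map_mul, map_sub, map_sub, hαg]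
    rcases hβor g with hg | hg
    · rw [hg, hγ_of_fix hg]
    · rw [hg, hγ_of_move hg, mul_comm (α - γ)]
  have htn : ‖t / algebraMap ℚ_[w] (PadicAlgCl w) u‖ = 1 := by
    rw [← pow_eq_one_iff_of_nonneg (norm_nonneg _) two_ne_zero, ← norm_pow, div_pow, ht2, sq,
      mul_div_mul_comm, norm_mul, nαβ, nαγ, one_mul]
  -- The unit `t / u` is fixed by the Frobenius, hence congruent to an integer; being a square root
  -- of an element of `ℚ_[w]`, it is fixed by every `g`.
  have htg (g : Gal(PadicAlgCl w/ℚ_[w])) : g t = t := by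
    have h1 := hσ _ htn.le
    rw [map_div₀, hσt, AlgEquiv.commutes] at h1
    obtain ⟨a, ha⟩ := exists_norm_sub_intCast_lt htn.le h1
    have h2 := hts.fixed_of_norm_sub_lt hw htn (a := (a : ℚ_[w])) (by rwa [map_intCast]) g
    rwa [map_div₀, AlgEquiv.commutes, div_left_inj' hu'] at h2
  refine isotropic_of_isUnipotent k hk huni (quadChar_lc ϖ) hϖs.quadChar_mul_apply hδ₀ hϖ₀ hϖ₁ hδ₁
    (padic_quadChar_span hw hϖ hD hDδ hδg) ?_
  refine obstruction_charCocycle _ _ _ _ _ _ _ _ (by rw [torsionBasis_zero]; rfl) hαg ht0 ?_ htg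
  -- The remaining identity says that the derivative of the monic cubic at `α` is `(α - β) * (α -
  -- γ)`, with `y₀ = -(a₁ α + a₃) / 2`.
  have e2 := h.b₂
  have e4 := h.b₄
  rw [b₂] at e2
  rw [b₄] at e4
  rw [ht2]
  linear_combination -(α / 2) * e2 - e4 / 2

end Local

/-! ### The choice of the neighbourhood -/

section Global

open WeierstrassCurve

lemma IsRoots.map {E : WeierstrassCurve ℚ} {F K L : Type*} [Field F] [Algebra ℚ F] [Field K]
    [Algebra ℚ K] [Field L] [Algebra K L] [Algebra ℚ L] {α β γ : F}
    (h : IsRoots (E.baseChange F) α β γ) (ι : F →ₐ[ℚ] L) :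
    IsRoots ((E.baseChange K).baseChange L) (ι α) (ι β) (ι γ) := by
  have hcomp (x : ℚ) : algebraMap K L (algebraMap ℚ K x) = ι (algebraMap ℚ F x) := by
    rw [AlgHom.commutes]
    exact congrArg (fun f : ℚ →+* L => f x)
      (Subsingleton.elim ((algebraMap K L).comp (algebraMap ℚ K)) (algebraMap ℚ L))
  obtain ⟨h2, h4, h6⟩ := h
  constructor
  · have := congrArg ι h2
    simpa [baseChange, hcomp, map_ofNat] using this
  · have := congrArg ι h4
    simpa [baseChange, hcomp, map_ofNat] using this
  · have := congrArg ι h6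
    simpa [baseChange, hcomp, map_ofNat] using this

lemma eventually_forall_mem_apply_eq {K L : Type*} [Field K] [Field L] [Algebra K L]
    [Algebra.IsIntegral K L] (S : Finset L) : ∀ᶠ φ : Gal(L/K) in 𝓝 1, ∀ x ∈ S, φ x = x := by
  rw [Filter.eventually_all_finset]
  intro x _
  exact (stabilizer_isOpen_of_isIntegral (K := K) x).mem_nhds (one_mem _)

end Global

/-! ### Involutions of three roots. -/

section Permutation

open WeierstrassCurve

/-- An automorphism whose square fixes the roots of the 2-division polynomial fixes a root. -/
lemma IsRoots.exists_fixed {K L : Type*} [Field K] [Field L] [CharZero L] [Algebra K L]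
    {W : WeierstrassCurve K} [W.IsElliptic] {T : Finset L} {α β γ : L}
    (h : IsRoots (W.baseChange L) α β γ) (hα : α ∈ T) (hβ : β ∈ T) (hγ : γ ∈ T)
    {σ : Gal(L/K)} (hσ : ∀ x ∈ T, σ (σ x) = x) :
    ∃ α' ∈ T, ∃ β' ∈ T, ∃ γ', IsRoots (W.baseChange L) α' β' γ' ∧ σ α' = α' := by
  have hβγ := h.swap₁₂.swap₂₃.ne
  have hαγ := h.swap₂₃.ne
  rcases (h.isDivRoot.gal σ).eq_or h with h1 | h1 | h1
  · exact ⟨α, hα, β, hβ, γ, h, h1⟩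
  -- Here `σ` swaps `α` and `β`, so by injectivity `γ` must be fixed.
  · refine ⟨γ, hγ, α, hα, β, h.swap₂₃.swap₁₂, ?_⟩
    have h2 : σ β = α := by rw [← h1, hσ α hα]
    rcases (h.swap₂₃.swap₁₂.isDivRoot.gal σ).eq_or h with h3 | h3 | h3
    · exact absurd (σ.injective (h2.trans h3.symm)) hβγ
    · exact absurd (σ.injective (h1.trans h3.symm)) hαγ
    · exact h3
  · refine ⟨β, hβ, α, hα, γ, h.swap₁₂, ?_⟩
    have h2 : σ γ = α := by rw [← h1, hσ α hα]
    rcases (h.swap₁₂.isDivRoot.gal σ).eq_or h with h3 | h3 | h3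
    · exact absurd (σ.injective (h2.trans h3.symm)) hβγ.symm
    · exact h3
    · exact absurd (σ.injective (h1.trans h3.symm)) h.ne

end Permutation

end GalCoh

end

theorem lemma8p5 (E : WeierstrassCurve ℚ) [E.IsElliptic] :
    ∃ U ∈ 𝓝 (1 : Gal(AlgebraicClosure ℚ/ℚ)),
      ∀ (k : Type*) [Field k] [Finite k] [Algebra (ZMod 2) k] (w : ℕ) [Fact w.Prime],
        w ≠ 2 → GalCoh.GoodReductionAt E w →
        (∃ φ, GalCoh.IsFrobenius w φ ∧ φ ^ 2 ∈ U) →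
        Module.finrank k (GalCoh.H1 (GalCoh.galV (E.baseChange ℚ_[w]) (PadicAlgCl w) k)) = 2 →
        (∃! W : Subrepresentation (GalCoh.galV (E.baseChange ℚ_[w]) (PadicAlgCl w) k),
          Module.finrank k W.toSubmodule = 1) ∧
        (∃! Q, GalCoh.IsScalarExtension (E.baseChange ℚ_[w]) (PadicAlgCl w) k Q) ∧
        ∀ (W : Subrepresentation (GalCoh.galV (E.baseChange ℚ_[w]) (PadicAlgCl w) k))
          (Q : QuadraticForm k (GalCoh.H1 (GalCoh.galV (E.baseChange ℚ_[w]) (PadicAlgCl w) k))),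
          Module.finrank k W.toSubmodule = 1 →
          GalCoh.IsScalarExtension (E.baseChange ℚ_[w]) (PadicAlgCl w) k Q →
          Module.finrank k (GalCoh.imageOfSub _ W) = 1 ∧
            ∀ x ∈ GalCoh.imageOfSub _ W, Q x = 0 := by
  have : Algebra.IsAlgebraic ℚ (AlgebraicClosure ℚ) := by
    rw [Subsingleton.elim (DivisionRing.toRatAlgebra : Algebra ℚ (AlgebraicClosure ℚ))
      (AlgebraicClosure.instAlgebra ℚ)]
    exact AlgebraicClosure.isAlgebraic ℚ
  obtain ⟨α, β, γ, h⟩ :=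
    GalCoh.IsRoots.exists_of_isAlgClosed (E.baseChange (AlgebraicClosure ℚ))
  choose sqrt hsqrt using fun x : AlgebraicClosure ℚ => IsAlgClosed.exists_pow_nat_eq x two_pos
  let T : Finset (AlgebraicClosure ℚ) := {α, β, γ}
  -- All ordered differences are included, because which root is fixed by the Frobenius depends on
  -- `w` while the neighbourhood may not.
  let S := T ∪ (T ×ˢ T).image fun p => sqrt (p.1 - p.2)
  refine ⟨_, GalCoh.eventually_forall_mem_apply_eq (K := ℚ) S, ?_⟩
  rintro k _ _ _ w _ hw hE ⟨φ, ⟨ι, σ, hσ, hισ⟩, hφ⟩ hk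
  have hfix (x) (hx : x ∈ S) : σ (σ (ι x)) = ι x := by
    rw [← hισ, ← hισ]
    exact congrArg ι (hφ x hx)
  obtain ⟨α', hα', β', hβ', γ', h', hσα⟩ := (h.map (K := ℚ_[w]) ι).exists_fixed (T := T.image ι)
    (σ := σ) (Finset.mem_image_of_mem _ (by simp [T])) (Finset.mem_image_of_mem _ (by simp [T]))
    (Finset.mem_image_of_mem _ (by simp [T])) (fun x hx => by
      obtain ⟨y, hy, rfl⟩ := Finset.mem_image.1 hx
      exact hfix y (Finset.mem_union_left _ hy))
  -- The renamed roots come from `ℚ̄`, so the square root chosen there for their difference is fixed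
  -- by the square of the Frobenius.
  obtain ⟨a, ha, rfl⟩ := Finset.mem_image.1 hα'
  obtain ⟨b, hb, rfl⟩ := Finset.mem_image.1 hβ'
  refine GalCoh.isotropic_of_frobenius_fixed k hw hE h' hσ hσα ⟨ι (sqrt (a - b)), ?_, ?_⟩ hk
  · rw [← map_pow, hsqrt, map_sub]
  · exact hfix _ (Finset.mem_union_right _
      (Finset.mem_image.2 ⟨(a, b), Finset.mem_product.2 ⟨ha, hb⟩, rfl⟩))
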